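/- Let $\Gamma_\star$ be the star graph with $n\ge 1$ edges, each identified with $[0,\infty)$ and attached at $0$ to the common vertex, so that $L^2(\Gamma_\star)=\bigoplus_{j=1}^n L^2(0,\infty)$ and $W^{k,2}(\Gamma_\star)=\bigoplus_{j=1}^n W^{k,2}(0,\infty)$. Let $A,B\in\mathbb C^{n\times n}$ be such that the $n\times 2n$ matrix $(A,B)$ has rank $n$ and $AB^\dagger$ is self-adjoint, and let $H_\star$ be the self-adjoint operator $H_\star f=-f''$ (edgewise) on $L^2(\Gamma_\star)$ with domain $\{f\in W^{2,2}(\Gamma_\star): A f(0)+B f'(0)=0\}$, where $f(0),f'(0)\in\mathbb C^n$ are the vectors of boundary values. Let $P_D,P_N,P_R=I-P_D-P_N$ be the mutually orthogonal orthogonal projections on $\mathbb C^n$, and $\Lambda$ the invertible self-adjoint operator on $P_R\mathbb C^n$, such that the condition $AF+BF'=0$ on $F,F'\in\mathbb C^n$ is equivalent to $P_DF=0$, $P_NF'=0$, $P_RF'=\Lambda P_RF$. Let $D(\mathcal E_\star)=\{f\in W^{1,2}(\Gamma_\star): P_Df(0)=0\}$, let $(e^{-itH_\star})_{t\in\mathbb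 R}$ and $(e^{it\Delta_{\mathbb R}})_{t\in\mathbb R}$ be the strongly continuous unitary groups on $L^2(\Gamma_\star)$ and $L^2(\mathbb R)$ generated by $-iH_\star$ and by $i\Delta_{\mathbb R}$ (with domain $W^{2,2}(\mathbb R)$), and let $P_c=I-P_p$, where $P_p$ is the orthogonal projection of $L^2(\Gamma_\star)$ onto the closed linear span of the eigenfunctions of $H_\star$. Assume that there is no Robin coupling, i.e. $P_R=0$. Then $H_\star$ has exactly $n_+(AB^\dagger)$ eigenvalues counted with multiplicity, where $n_+(AB^\dagger)$ is the number of positive eigenvalues of $AB^\dagger$ with multiplicity. Let $(\lambda_l,\varphi_l)$, $1\le l\le n_+(AB^\dagger)$, be the eigencouples of $H_\star$, with $(\varphi_l)$ orthonormal and spanning all eigenfunctions. For every $v\in D(\mathcal E_\star)$ and every $t\in\mathbb R$, the function $e^{-itH_\star}v$ belongs to $W^{1,2}(\Gamma_\star)$ and $$\partial_x\big(e^{-itH_\star}v\big)=-\,e^{-itH_\star}P_c\,v'+2\,e^{it\Delta_{\mathbb R}}\widetilde{v'}+\sum_{l=1}^{n_+(AB^\dagger)}\langle v,\varphi_l\rangle\,e^{-it\lambda_l}\,\varphi_l'\qquad\text{in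 }L^2(\Gamma_\star),$$ where $\langle\cdot,\cdot\rangle$ is the inner product of $L^2(\Gamma_\star)$, linear in its first argument, $\widetilde{v'}=(\widetilde{v_1'},\dots,\widetilde{v_n'})$ is the edgewise extension of $v'$ by zero to $(-\infty,0)$, and the second term on the right is, on the $j$-th edge, the restriction of $2e^{it\Delta_{\mathbb R}}\widetilde{v_j'}$ to $(0,\infty)$. -/

import Mathlib

open MeasureTheory Set
open scoped ContDiff Matrix

noncomputable section

namespace StarGraph

/-! ### Weak derivatives and boundary values -/

/-- `g` is the weak derivative of `f` on the open set `Ω ⊆ ℝ` (for locally integrable `f`, `g`). -/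
def HasWeakDeriv (Ω : Set ℝ) (f g : ℝ → ℂ) : Prop :=
  ∀ φ : ℝ → ℝ, ContDiff ℝ ∞ φ → HasCompactSupport φ → tsupport φ ⊆ Ω →
    ∫ x in Ω, deriv φ x • f x = -∫ x in Ω, φ x • g x

/-- `L²(0, ∞)`, the square integrable functions on one edge. -/
abbrev L2Edge : Type := Lp ℂ 2 (volume.restrict (Ioi (0 : ℝ)))

/-- `L²(ℝ)`. -/
abbrev L2Line : Type := Lp ℂ 2 (volume : Measure ℝ)

/-- `L²(Γ⋆) = ⨁ⱼ L²(0, ∞)`, for the star graph with `n` edges. -/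
abbrev L2Star (n : ℕ) : Type := PiLp 2 (fun _ : Fin n => L2Edge)

/-- `a` is the value at the vertex of (the continuous version of) `f`. -/
def HasBoundaryValue (f : L2Edge) (a : ℂ) : Prop :=
  ∃ F : ℝ → ℂ, ContinuousOn F (Ici 0) ∧ f =ᵐ[volume.restrict (Ioi (0 : ℝ))] F ∧ F 0 = a

/-- `f ∈ W^{1,2}(Γ⋆)` with edgewise weak derivative `g`. -/
def IsDeriv {n : ℕ} (f g : L2Star n) : Prop :=
  ∀ j, HasWeakDeriv (Ioi 0) (f j) (g j)

/-- `a` is the vector of the values of `f` at the vertex along the `n` edges. -/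
def IsVertexValue {n : ℕ} (f : L2Star n) (a : Fin n → ℂ) : Prop :=
  ∀ j, HasBoundaryValue (f j) (a j)

/-! ### Basic facts about weak derivatives, so that the operators below are well defined -/

theorem integrable_test_smul {Ω : Set ℝ} {f : ℝ → ℂ} (hf : MemLp f 2 (volume.restrict Ω))
    {φ : ℝ → ℝ} (hφ : Continuous φ) (hc : HasCompactSupport φ) :
    Integrable (fun x => φ x • f x) (volume.restrict Ω) :=
  (hf.locallyIntegrable (by norm_num)).integrable_smul_left_of_hasCompactSupport hφ hc

theorem HasWeakDeriv.congr {Ω : Set ℝ} {f g f₁ g₁ : ℝ → ℂ} (h : HasWeakDeriv Ω f g)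
    (hf : f₁ =ᵐ[volume.restrict Ω] f) (hg : g₁ =ᵐ[volume.restrict Ω] g) :
    HasWeakDeriv Ω f₁ g₁ := by
  intro φ h1 h2 h3
  have e1 : ∫ x in Ω, deriv φ x • f₁ x = ∫ x in Ω, deriv φ x • f x :=
    integral_congr_ae (hf.mono fun x hx => by simp only [hx])
  have e2 : ∫ x in Ω, φ x • g₁ x = ∫ x in Ω, φ x • g x :=
    integral_congr_ae (hg.mono fun x hx => by simp only [hx])
  rw [e1, e2]
  exact h φ h1 h2 h3

theorem HasWeakDeriv.add {Ω : Set ℝ} {f g f₁ g₁ : ℝ → ℂ}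
    (hf : MemLp f 2 (volume.restrict Ω)) (hg : MemLp g 2 (volume.restrict Ω))
    (hf₁ : MemLp f₁ 2 (volume.restrict Ω)) (hg₁ : MemLp g₁ 2 (volume.restrict Ω))
    (h : HasWeakDeriv Ω f g) (h₁ : HasWeakDeriv Ω f₁ g₁) :
    HasWeakDeriv Ω (f + f₁) (g + g₁) := by
  intro φ k1 k2 k3
  have c' : Continuous (deriv φ) := k1.continuous_deriv (by simp)
  simp only [Pi.add_apply, smul_add]
  rw [integral_add (integrable_test_smul hf c' k2.deriv) (integrable_test_smul hf₁ c' k2.deriv),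
    integral_add (integrable_test_smul hg k1.continuous k2)
      (integrable_test_smul hg₁ k1.continuous k2), h φ k1 k2 k3, h₁ φ k1 k2 k3]
  ring

theorem HasWeakDeriv.const_smul {Ω : Set ℝ} {f g : ℝ → ℂ} (c : ℂ) (h : HasWeakDeriv Ω f g) :
    HasWeakDeriv Ω (c • f) (c • g) := by
  intro φ k1 k2 k3
  simp only [Pi.smul_apply, smul_comm _ c]
  rw [integral_smul, integral_smul, h φ k1 k2 k3, smul_neg]

theorem HasWeakDeriv.zero (Ω : Set ℝ) : HasWeakDeriv Ω 0 0 := by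
  intro φ _ _ _
  simp

theorem HasWeakDeriv.eq_zero {Ω : Set ℝ} (hΩ : IsOpen Ω) {f g : ℝ → ℂ}
    (hg : MemLp g 2 (volume.restrict Ω)) (h : HasWeakDeriv Ω f g)
    (hf : f =ᵐ[volume.restrict Ω] 0) : g =ᵐ[volume.restrict Ω] 0 := by
  have hl : LocallyIntegrableOn g Ω volume :=
    locallyIntegrableOn_of_locallyIntegrable_restrict (hg.locallyIntegrable (by norm_num))
  have key := hΩ.ae_eq_zero_of_integral_contDiff_smul_eq_zero hl (fun φ k1 k2 k3 => by
    have e : ∫ x, φ x • g x = ∫ x in Ω, φ x • g x := by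
      refine (setIntegral_eq_integral_of_forall_compl_eq_zero fun x hx => ?_).symm
      rw [image_eq_zero_of_notMem_tsupport fun hx' => hx (k3 hx'), zero_smul]
    have := (h.congr hf.symm Filter.EventuallyEq.rfl) φ k1 k2 k3
    rw [e]
    simpa using this)
  exact (ae_restrict_iff' hΩ.measurableSet).2 key

theorem HasBoundaryValue.add {f g : L2Edge} {a b : ℂ} (hf : HasBoundaryValue f a)
    (hg : HasBoundaryValue g b) : HasBoundaryValue (f + g) (a + b) := by
  obtain ⟨F, h1, h2, h3⟩ := hf
  obtain ⟨G, k1, k2, k3⟩ := hg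
  exact ⟨F + G, h1.add k1, (Lp.coeFn_add f g).trans (h2.add k2), by simp [h3, k3]⟩

theorem HasBoundaryValue.const_smul {f : L2Edge} {a : ℂ} (c : ℂ) (hf : HasBoundaryValue f a) :
    HasBoundaryValue (c • f) (c * a) := by
  obtain ⟨F, h1, h2, h3⟩ := hf
  exact ⟨c • F, h1.const_smul c, (Lp.coeFn_smul c f).trans (h2.const_smul c), by simp [h3]⟩

theorem HasBoundaryValue.zero : HasBoundaryValue 0 0 :=
  ⟨0, continuousOn_const, Lp.coeFn_zero _ _ _, rfl⟩

theorem IsDeriv.add {n : ℕ} {f g f₁ g₁ : L2Star n} (h : IsDeriv f g) (h₁ : IsDeriv f₁ g₁) :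
    IsDeriv (f + f₁) (g + g₁) := fun j =>
  ((h j).add (Lp.memLp _) (Lp.memLp _) (Lp.memLp _) (Lp.memLp _) (h₁ j)).congr
    (Lp.coeFn_add _ _) (Lp.coeFn_add _ _)

theorem IsDeriv.const_smul {n : ℕ} {f g : L2Star n} (c : ℂ) (h : IsDeriv f g) :
    IsDeriv (c • f) (c • g) := fun j =>
  ((h j).const_smul c).congr (Lp.coeFn_smul _ _) (Lp.coeFn_smul _ _)

theorem IsDeriv.zero {n : ℕ} : IsDeriv (0 : L2Star n) 0 := fun _ =>
  (HasWeakDeriv.zero _).congr (Lp.coeFn_zero _ _ _) (Lp.coeFn_zero _ _ _)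

theorem IsDeriv.eq_zero {n : ℕ} {g : L2Star n} (h : IsDeriv 0 g) : g = 0 := by
  ext1 j
  have := (h j).eq_zero isOpen_Ioi (Lp.memLp _) (Lp.coeFn_zero _ _ _)
  exact Lp.ext (this.trans (Lp.coeFn_zero _ _ _).symm)

/-! ### The Hamiltonian on the star graph and the free Laplacian on the line -/

/-- The graph of `H⋆ = -Δ(A, B)`: the pairs `(f, -f'')` with `f ∈ W^{2,2}(Γ⋆)` and
`A f(0) + B f'(0) = 0`. -/
def hamiltonianGraph {n : ℕ} (A B : Matrix (Fin n) (Fin n) ℂ) :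
    Submodule ℂ (L2Star n × L2Star n) where
  carrier := {p | ∃ (f' : L2Star n) (a b : Fin n → ℂ), IsDeriv p.1 f' ∧ IsDeriv f' (-p.2) ∧
    IsVertexValue p.1 a ∧ IsVertexValue f' b ∧ A *ᵥ a + B *ᵥ b = 0}
  add_mem' := by
    rintro ⟨f, g⟩ ⟨f₁, g₁⟩ ⟨f', a, b, h1, h2, h3, h4, h5⟩ ⟨f₁', a₁, b₁, k1, k2, k3, k4, k5⟩
    refine ⟨f' + f₁', a + a₁, b + b₁, h1.add k1, ?_, fun j => (h3 j).add (k3 j),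
      fun j => (h4 j).add (k4 j), ?_⟩
    · have := h2.add k2
      rwa [← neg_add] at this
    · rw [Matrix.mulVec_add, Matrix.mulVec_add, add_add_add_comm, h5, k5, add_zero]
  zero_mem' := ⟨0, 0, 0, IsDeriv.zero, by simpa using IsDeriv.zero,
    fun _ => HasBoundaryValue.zero, fun _ => HasBoundaryValue.zero, by simp⟩
  smul_mem' := by
    rintro c ⟨f, g⟩ ⟨f', a, b, h1, h2, h3, h4, h5⟩
    refine ⟨c • f', c • a, c • b, h1.const_smul c, ?_, fun j => (h3 j).const_smul c,
      fun j => (h4 j).const_smul c, ?_⟩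
    · have := h2.const_smul c
      simpa [smul_neg] using this
    · rw [Matrix.mulVec_smul, Matrix.mulVec_smul, ← smul_add, h5, smul_zero]

/-- The Hamiltonian `H⋆ = -Δ(A, B)` on `L²(Γ⋆)`, an unbounded operator. -/
def hamiltonian {n : ℕ} (A B : Matrix (Fin n) (Fin n) ℂ) : L2Star n →ₗ.[ℂ] L2Star n :=
  (hamiltonianGraph A B).toLinearPMap

theorem hamiltonian_graph {n : ℕ} (A B : Matrix (Fin n) (Fin n) ℂ) :
    (hamiltonian A B).graph = hamiltonianGraph A B := by
  refine Submodule.toLinearPMap_graph_eq _ ?_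
  rintro ⟨f, g⟩ ⟨f', a, b, h1, h2, -⟩ hf
  simp only at hf h1 h2
  subst hf
  rw [h1.eq_zero] at h2
  simpa using h2.eq_zero

/-- The graph of the free Laplacian on `ℝ`: the pairs `(f, f'')` with `f ∈ W^{2,2}(ℝ)`. -/
def laplacianLineGraph : Submodule ℂ (L2Line × L2Line) where
  carrier := {p | ∃ f' : L2Line, HasWeakDeriv univ p.1 f' ∧ HasWeakDeriv univ f' p.2}
  add_mem' := by
    rintro ⟨f, g⟩ ⟨f₁, g₁⟩ ⟨f', h1, h2⟩ ⟨f₁', k1, k2⟩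
    have m : ∀ u : L2Line, MemLp u 2 (volume.restrict univ) := fun u => (Lp.memLp u).restrict _
    refine ⟨f' + f₁', (h1.add (m _) (m _) (m _) (m _) k1).congr ?_ ?_,
      (h2.add (m _) (m _) (m _) (m _) k2).congr ?_ ?_⟩ <;>
    exact ae_restrict_of_ae (Lp.coeFn_add _ _)
  zero_mem' := ⟨0, (HasWeakDeriv.zero _).congr (ae_restrict_of_ae (Lp.coeFn_zero _ _ _))
      (ae_restrict_of_ae (Lp.coeFn_zero _ _ _)),
    (HasWeakDeriv.zero _).congr (ae_restrict_of_ae (Lp.coeFn_zero _ _ _))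
      (ae_restrict_of_ae (Lp.coeFn_zero _ _ _))⟩
  smul_mem' := by
    rintro c ⟨f, g⟩ ⟨f', h1, h2⟩
    refine ⟨c • f', (h1.const_smul c).congr ?_ ?_, (h2.const_smul c).congr ?_ ?_⟩ <;>
    exact ae_restrict_of_ae (Lp.coeFn_smul _ _)

/-- The free Laplacian `Δ_ℝ` on `L²(ℝ)`, with domain `W^{2,2}(ℝ)`. -/
def laplacianLine : L2Line →ₗ.[ℂ] L2Line :=
  laplacianLineGraph.toLinearPMap

theorem laplacianLine_graph : laplacianLine.graph = laplacianLineGraph := by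
  refine Submodule.toLinearPMap_graph_eq _ ?_
  rintro ⟨f, g⟩ ⟨f', h1, h2⟩ hf
  have m : ∀ u : L2Line, MemLp u 2 (volume.restrict univ) := fun u => (Lp.memLp u).restrict _
  simp only at hf h1 h2
  subst hf
  have e1 := h1.eq_zero isOpen_univ (m _) (ae_restrict_of_ae (Lp.coeFn_zero _ _ _))
  have e2 := h2.eq_zero isOpen_univ (m _) e1
  rw [Measure.restrict_univ] at e2
  exact Lp.ext (e2.trans (Lp.coeFn_zero _ _ _).symm)

/-! ### Unitary groups -/

/-- `U` is a strongly continuous group of isometries whose infinitesimal generator is exactly `T`: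
`f` lies in the domain of `T` and `T f = g` if and only if `t ↦ U t f` has derivative `g` at `0`. -/
structure IsGroupGeneratedBy {E : Type*} [NormedAddCommGroup E] [NormedSpace ℂ E]
    (U : ℝ → E →L[ℂ] E) (T : E →ₗ.[ℂ] E) : Prop where
  map_zero : U 0 = 1
  map_add : ∀ s t, U (s + t) = U s * U t
  norm_map : ∀ t f, ‖U t f‖ = ‖f‖
  continuous : ∀ f, Continuous fun t => U t f
  generator : ∀ f g, (f, g) ∈ T.graph ↔ HasDerivAt (fun t => U t f) g 0

open Classical in
/-- The strongly continuous group of isometries `(e^{tT})_{t ∈ ℝ}` generated by `T`; it is unique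
when it exists, and it exists for `T = -iH` with `H` self-adjoint. -/
def expGroup {E : Type*} [NormedAddCommGroup E] [NormedSpace ℂ E] (T : E →ₗ.[ℂ] E) :
    ℝ → E →L[ℂ] E :=
  if h : ∃ U, IsGroupGeneratedBy U T then h.choose else 0

/-- `e^{-itH⋆}`. -/
def starGroup {n : ℕ} (A B : Matrix (Fin n) (Fin n) ℂ) : ℝ → L2Star n →L[ℂ] L2Star n :=
  expGroup ((-Complex.I) • hamiltonian A B)

/-- `e^{itΔ_ℝ}`. -/
def freeGroup : ℝ → L2Line →L[ℂ] L2Line :=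
  expGroup (Complex.I • laplacianLine)

/-! ### Extension by zero and the free group acting edge by edge -/

/-- The extension by zero of a function on `(0, ∞)` to `ℝ`. -/
def extendZero (f : L2Edge) : L2Line :=
  ((memLp_indicator_iff_restrict measurableSet_Ioi).2 (Lp.memLp f)).toLp ((Ioi (0 : ℝ)).indicator f)

/-- The restriction of a function on `ℝ` to `(0, ∞)`. -/
def restrictEdge (f : L2Line) : L2Edge :=
  ((Lp.memLp f).restrict (Ioi (0 : ℝ))).toLp f

/-- On every edge, the restriction to that edge of `e^{itΔ_ℝ}` applied to the extension by zero. -/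
def freeGroupOnEdges {n : ℕ} (t : ℝ) (f : L2Star n) : L2Star n :=
  WithLp.toLp 2 fun j => restrictEdge (freeGroup t (extendZero (f j)))

/-! ### Coupling conditions at the vertex -/

/-- The decomposition of the coupling condition `A F + B F' = 0` into its Dirichlet, Neumann and
Robin parts: mutually orthogonal orthogonal projections `PD`, `PN`, `PR` with sum `1`, and an
invertible self-adjoint operator `L` acting on the range of `PR` (encoded as a Hermitian matrix
that lives on this range). -/
structure CouplingParts {n : ℕ} (A B : Matrix (Fin n) (Fin n) ℂ) where
  PD : Matrix (Fin n) (Fin n) ℂ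
  PN : Matrix (Fin n) (Fin n) ℂ
  PR : Matrix (Fin n) (Fin n) ℂ
  L : Matrix (Fin n) (Fin n) ℂ
  projD : IsStarProjection PD
  projN : IsStarProjection PN
  projR : IsStarProjection PR
  orthDN : PD * PN = 0
  orthDR : PD * PR = 0
  orthNR : PN * PR = 0
  sum_eq : PR = 1 - PD - PN
  hermL : L.IsHermitian
  rangeL : PR * L * PR = L
  invL : ∃ K, PR * K * PR = K ∧ L * K = PR ∧ K * L = PR
  coupling : ∀ F F' : Fin n → ℂ, A *ᵥ F + B *ᵥ F' = 0 ↔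
    PD *ᵥ F = 0 ∧ PN *ᵥ F' = 0 ∧ PR *ᵥ F' = L *ᵥ (PR *ᵥ F)

/-- The form domain `D(E⋆) = {f ∈ W^{1,2}(Γ⋆) : PD f(0) = 0}`. -/
def formDomain {n : ℕ} (PD : Matrix (Fin n) (Fin n) ℂ) : Set (L2Star n) :=
  {f | (∃ f', IsDeriv f f') ∧ ∃ a, IsVertexValue f a ∧ PD *ᵥ a = 0}

/-! ### Eigenfunctions -/

/-- The eigenfunctions of an unbounded operator. -/
def eigenfunctions {E : Type*} [AddCommGroup E] [Module ℂ E] (T : E →ₗ.[ℂ] E) : Set E :=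
  {f | f ≠ 0 ∧ ∃ lam : ℂ, (f, lam • f) ∈ T.graph}

/-- `P_c = I - P_p`, with `P_p` the orthogonal projection onto the closed span of the
eigenfunctions. -/
def projC {E : Type*} [NormedAddCommGroup E] [InnerProductSpace ℂ E] [CompleteSpace E]
    (T : E →ₗ.[ℂ] E) : E →L[ℂ] E :=
  1 - (Submodule.span ℂ (eigenfunctions T)).topologicalClosure.starProjection

/-- `(lam l, φ l)` is a complete list of the eigencouples of `T`, counted with multiplicity: the
`φ l` are orthonormal eigenfunctions to the eigenvalues `lam l`, and they span all
eigenfunctions. -/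
structure IsEigencouples {E ι : Type*} [NormedAddCommGroup E] [InnerProductSpace ℂ E]
    (T : E →ₗ.[ℂ] E) (lam : ι → ℝ) (φ : ι → E) : Prop where
  orthonormal : Orthonormal ℂ φ
  eigen : ∀ l, (φ l, (lam l : ℂ) • φ l) ∈ T.graph
  complete : eigenfunctions T ⊆ Submodule.span ℂ (Set.range φ)

/-- `n₊(M)`, the number of positive eigenvalues of a Hermitian matrix, with multiplicity. -/
def numPosEigenvalues {n : ℕ} {M : Matrix (Fin n) (Fin n) ℂ} (hM : M.IsHermitian) : ℕ :=
  (Finset.univ.filter fun i => 0 < hM.eigenvalues i).card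

end StarGraph

end

/-! Without a Robin part, the vertex condition says that `f(0)` lies in the `+1` eigenspace, and
`f'(0)` in the `-1` eigenspace, of the reflection `S = P_N - P_D` of `ℂⁿ`. Extending `f` to `n`
functions on the line by the rule `f(-x) = S f(x)` therefore turns `H⋆` into `-Δ_ℝ` on the invariant
subspace of these extensions, so that `e^{-itH⋆}` is extension, followed by `e^{itΔ_ℝ}`, followed by
restriction; in particular `H⋆` has no eigenfunctions, since `Δ_ℝ` has none. The derivative turns
the rule with `S` into the rule with `-S`, and the extension of `v'` by `-S` is `2 ṽ'` minus its
extension by `S`, whence the formula for `∂ₓ e^{-itH⋆} v`. On the line, the Fourier transform turns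
`Δ_ℝ` into a multiplication operator, and the uniqueness of the group with a given generator
identifies all the groups. -/

noncomputable section

namespace StarGraph

open Filter Topology
open scoped SchwartzMap FourierTransform LineDeriv

/-! ### Strongly continuous groups of isometries -/

section Groups

variable {E F : Type*} [NormedAddCommGroup E] [NormedSpace ℂ E] [NormedAddCommGroup F]
  [NormedSpace ℂ F] {T : E →ₗ.[ℂ] E} {U V : ℝ → E →L[ℂ] E}

theorem hasDerivAt_clm_apply {u : ℝ → E} {g : E} {t : ℝ} (h : HasDerivAt u g t)
    (L : E →L[ℂ] F) : HasDerivAt (fun s => L (u s)) (L g) t :=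
  (L.restrictScalars ℝ).hasFDerivAt.comp_hasDerivAt t h

theorem hasDerivAt_zero_iff_tendsto_slope {u : ℝ → E} {g : E} :
    HasDerivAt u g 0 ↔
      Tendsto (fun t : ℝ => ((t⁻¹ : ℝ) : ℂ) • (u t - u 0)) (𝓝[≠] 0) (𝓝 g) := by
  rw [hasDerivAt_iff_tendsto_slope_zero]
  simp only [zero_add]
  rfl

/-- A strongly continuous one-parameter group of isometries, with no reference to its
generator. -/
structure IsIsometryGroup (U : ℝ → E →L[ℂ] E) : Prop where
  map_zero : U 0 = 1
  map_add : ∀ s t, U (s + t) = U s * U t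
  norm_map : ∀ t f, ‖U t f‖ = ‖f‖
  continuous : ∀ f, Continuous fun t => U t f

theorem IsGroupGeneratedBy.isIsometryGroup (hU : IsGroupGeneratedBy U T) : IsIsometryGroup U :=
  ⟨hU.map_zero, hU.map_add, hU.norm_map, hU.continuous⟩

namespace IsIsometryGroup

theorem isGroupGeneratedBy (hU : IsIsometryGroup U)
    (h : ∀ f g, (f, g) ∈ T.graph ↔ HasDerivAt (fun t => U t f) g 0) : IsGroupGeneratedBy U T :=
  ⟨hU.map_zero, hU.map_add, hU.norm_map, hU.continuous, h⟩

theorem add_apply (hU : IsIsometryGroup U) (s t : ℝ) (f : E) : U (s + t) f = U s (U t f) := by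
  rw [hU.map_add, mul_apply_eq_comp]

theorem zero_apply (hU : IsIsometryGroup U) (f : E) : U 0 f = f := by
  rw [hU.map_zero, one_apply_eq_self]

theorem neg_apply_apply (hU : IsIsometryGroup U) (s : ℝ) (f : E) : U (-s) (U s f) = f := by
  rw [← hU.add_apply, neg_add_cancel, hU.zero_apply]

theorem apply_neg_apply (hU : IsIsometryGroup U) (s : ℝ) (f : E) : U s (U (-s) f) = f := by
  simpa only [neg_neg] using hU.neg_apply_apply (-s) f

theorem hasDerivAt_integral (hU : IsIsometryGroup U) [CompleteSpace E] (x : E) (a b : ℝ) :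
    HasDerivAt (fun u => ∫ s in a..u, U s x) (U b x) b :=
  intervalIntegral.integral_hasDerivAt_right ((hU.continuous x).intervalIntegrable a b)
    (hU.continuous x).aestronglyMeasurable.stronglyMeasurableAtFilter
    (hU.continuous x).continuousAt

theorem apply_integral (hU : IsIsometryGroup U) [CompleteSpace E] (x : E) (h t : ℝ) :
    U t (∫ s in (0 : ℝ)..h, U s x) = (∫ s in (0 : ℝ)..t + h, U s x) - ∫ s in (0 : ℝ)..t, U s x := by
  have hint : ∀ a b, IntervalIntegrable (fun s => U s x) volume a b :=
    fun a b => (hU.continuous x).intervalIntegrable a b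
  rw [← ContinuousLinearMap.intervalIntegral_comp_comm _ (hint 0 h)]
  simp only [← hU.add_apply]
  rw [intervalIntegral.integral_comp_add_left (fun s => U s x) t, add_zero,
    intervalIntegral.integral_interval_sub_left (hint _ _) (hint _ _)]

theorem hasDerivAt_apply_integral (hU : IsIsometryGroup U) [CompleteSpace E] (x : E) (h : ℝ) :
    HasDerivAt (fun t => U t (∫ s in (0 : ℝ)..h, U s x)) (U h x - x) 0 := by
  simp only [hU.apply_integral]
  have hleft := (hU.hasDerivAt_integral x 0 (0 + h)).comp_add_const 0 h
  have hright := hU.hasDerivAt_integral x 0 0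
  simpa only [zero_add, hU.zero_apply] using hleft.fun_sub hright

/-- If `t ↦ U t` and `t ↦ V t` are differentiable at `0` on `f` with the same derivative, then
`U (-t) V t f` has derivative `0` at `0`; the isometry `U (-t)` only multiplies the difference
quotient. -/
theorem hasDerivAt_neg_apply_apply (hU : IsIsometryGroup U) (hV : IsIsometryGroup V) {f g : E}
    {s : ℝ} (hUf : HasDerivAt (fun t => U t (V s f)) g 0)
    (hVf : HasDerivAt (fun t => V t (V s f)) g 0) :
    HasDerivAt (fun t => U (-t) (V t f)) 0 s := by
  have hdiff : HasDerivAt (fun h => V h (V s f) - U h (V s f)) 0 0 := by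
    simpa only [sub_self] using hVf.fun_sub hUf
  rw [hasDerivAt_iff_isLittleO_nhds_zero] at hdiff ⊢
  refine Asymptotics.IsLittleO.of_norm_left (hdiff.norm_left.congr_left fun h => ?_)
  have hnear : U (-(s + h)) (V (s + h) f) = U (-s) (U (-h) (V h (V s f))) := by
    rw [← hV.add_apply, ← hU.add_apply, add_comm h s, neg_add]
  have hbase : U (-s) (V s f) = U (-s) (U (-h) (U h (V s f))) := by
    rw [hU.neg_apply_apply]
  simp only [hnear, hbase, smul_zero, sub_zero, zero_add, hV.zero_apply, hU.zero_apply, sub_self]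
  rw [← map_sub, ← map_sub, hU.norm_map, hU.norm_map]

/-- A group on `F` restricts to a group on `E` when `E` is embedded by `J`, with left inverse `P`,
as an invariant subspace of `F`. -/
theorem pullback {W : ℝ → F →L[ℂ] F} (hW : IsIsometryGroup W) {J : E →L[ℂ] F} {P : F →L[ℂ] E}
    {c : ℝ} (hc : c ≠ 0) (hJ : ∀ f, ‖J f‖ = c * ‖f‖) (hPJ : ∀ f, P (J f) = f)
    (hinv : ∀ t f, J (P (W t (J f))) = W t (J f)) :
    IsIsometryGroup fun t => P ∘L W t ∘L J where
  map_zero := by ext f; simp [hW.map_zero, hPJ]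
  map_add s t := by ext f; simp [hinv, hW.map_add]
  norm_map t f := by
    refine mul_left_cancel₀ hc ?_
    simp only [ContinuousLinearMap.comp_apply]
    rw [← hJ, hinv, hW.norm_map, hJ]
  continuous f := P.continuous.comp (hW.continuous (J f))

end IsIsometryGroup

theorem hasDerivAt_pullback_iff {w : ℝ → F} {J : E →L[ℂ] F} {P : F →L[ℂ] E} {t : ℝ} {g : E}
    (hPJ : ∀ f, P (J f) = f) (hinv : ∀ t, J (P (w t)) = w t) :
    HasDerivAt (fun t => P (w t)) g t ↔ HasDerivAt w (J g) t := by
  constructor <;> intro h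
  · simpa only [hinv] using hasDerivAt_clm_apply h J
  · simpa only [hPJ] using hasDerivAt_clm_apply h P

namespace IsGroupGeneratedBy

theorem map_graph (hU : IsGroupGeneratedBy U T) {f g : E} (h : (f, g) ∈ T.graph) (s : ℝ) :
    (U s f, U s g) ∈ T.graph := by
  rw [hU.generator] at h ⊢
  have hcomm : (fun t => U t (U s f)) = fun t => U s (U t f) := by
    funext t
    rw [← hU.isIsometryGroup.add_apply, ← hU.isIsometryGroup.add_apply, add_comm]
  rw [hcomm]
  exact hasDerivAt_clm_apply h (U s)

theorem dense_domain [CompleteSpace E] (hU : IsGroupGeneratedBy U T) :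
    Dense {f : E | ∃ g, (f, g) ∈ T.graph} := by
  intro x
  have hlim := hasDerivAt_zero_iff_tendsto_slope.1 (hU.isIsometryGroup.hasDerivAt_integral x 0 0)
  simp only [intervalIntegral.integral_same, sub_zero, hU.isIsometryGroup.zero_apply] at hlim
  refine mem_closure_of_tendsto hlim (Eventually.of_forall fun h => ?_)
  exact ⟨_, T.graph.smul_mem ((h⁻¹ : ℝ) : ℂ)
    ((hU.generator _ _).2 (hU.isIsometryGroup.hasDerivAt_apply_integral x h))⟩

theorem neg_apply_apply_of_mem_domain (hU : IsGroupGeneratedBy U T) (hV : IsGroupGeneratedBy V T)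
    {f g : E} (h : (f, g) ∈ T.graph) (t : ℝ) : U (-t) (V t f) = f := by
  have hderiv : ∀ s, HasDerivAt (fun s => U (-s) (V s f)) 0 s := fun s =>
    hU.isIsometryGroup.hasDerivAt_neg_apply_apply hV.isIsometryGroup
      ((hU.generator _ _).1 (hV.map_graph h s)) ((hV.generator _ _).1 (hV.map_graph h s))
  have hconst := is_const_of_deriv_eq_zero (fun s => (hderiv s).differentiableAt)
    (fun s => (hderiv s).deriv) t 0
  simpa [hU.map_zero, hV.map_zero] using hconst

theorem unique [CompleteSpace E] (hU : IsGroupGeneratedBy U T) (hV : IsGroupGeneratedBy V T) :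
    U = V := by
  funext t
  have hinv : (fun f => U (-t) (V t f)) = id :=
    Continuous.ext_on hU.dense_domain ((U (-t)).continuous.comp (V t).continuous) continuous_id
      fun f ⟨_, hfg⟩ => hU.neg_apply_apply_of_mem_domain hV hfg t
  ext f
  rw [← hU.isIsometryGroup.apply_neg_apply t (V t f)]
  exact congrArg (U t) (congrFun hinv f).symm

theorem expGroup_eq [CompleteSpace E] (hU : IsGroupGeneratedBy U T) : expGroup T = U := by
  have hex : ∃ U, IsGroupGeneratedBy U T := ⟨U, hU⟩
  rw [expGroup, dif_pos hex]
  exact hex.choose_spec.unique hU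

end IsGroupGeneratedBy

section Diagonal

variable {ι : Type*}

/-- The operator that acts as `S` on every component of a vector. -/
def diagonal (S : E →L[ℂ] F) : PiLp 2 (fun _ : ι => E) →L[ℂ] PiLp 2 (fun _ : ι => F) :=
  (PiLp.continuousLinearEquiv 2 ℂ fun _ : ι => F).symm ∘L
    ContinuousLinearMap.piMap (fun _ => S) ∘L
      (PiLp.continuousLinearEquiv 2 ℂ fun _ : ι => E).toContinuousLinearMap

theorem diagonal_apply (S : E →L[ℂ] F) (f : PiLp 2 fun _ : ι => E) (i : ι) :
    diagonal S f i = S (f i) := rfl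

variable [Fintype ι]

theorem IsIsometryGroup.diagonal (hU : IsIsometryGroup U) :
    IsIsometryGroup fun t => (StarGraph.diagonal (U t) :
      PiLp 2 (fun _ : ι => E) →L[ℂ] PiLp 2 fun _ : ι => E) where
  map_zero := by ext f i; simp [diagonal_apply, hU.map_zero]
  map_add s t := by ext f i; simp [diagonal_apply, hU.map_add]
  norm_map t f := by simp only [PiLp.norm_eq_of_L2, diagonal_apply, hU.norm_map]
  continuous f := (PiLp.continuous_toLp 2 _).comp
    (continuous_pi fun i => hU.continuous (f i))

theorem hasDerivAt_piLp {u : ℝ → PiLp 2 fun _ : ι => E} {g : PiLp 2 fun _ : ι => E} {t : ℝ} :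
    HasDerivAt u g t ↔ ∀ i, HasDerivAt (fun s => u s i) (g i) t := by
  simp only [hasDerivAt_iff_hasFDerivAt, ← hasFDerivWithinAt_univ]
  exact hasFDerivWithinAt_piLp 2

end Diagonal

end Groups

section MatrixAction

variable {ι E F : Type*} [Fintype ι] [NormedAddCommGroup E] [NormedAddCommGroup F]

section NormedSpace

variable [NormedSpace ℂ E] [NormedSpace ℂ F]

/-- The action of a complex matrix on the vectors with entries in a complex normed space. -/
def matrixAction (S : Matrix ι ι ℂ) : PiLp 2 (fun _ : ι => E) →L[ℂ] PiLp 2 (fun _ : ι => E) :=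
  (PiLp.continuousLinearEquiv 2 ℂ fun _ : ι => E).symm ∘L
    ContinuousLinearMap.pi fun j => ∑ k, S j k • PiLp.proj 2 (fun _ : ι => E) k

theorem matrixAction_apply (S : Matrix ι ι ℂ) (f : PiLp 2 fun _ : ι => E) (j : ι) :
    matrixAction S f j = ∑ k, S j k • f k := by
  simp [matrixAction]

theorem matrixAction_one [DecidableEq ι] (f : PiLp 2 fun _ : ι => E) :
    matrixAction (1 : Matrix ι ι ℂ) f = f := by
  ext j
  simp [matrixAction_apply, Matrix.one_apply]

theorem matrixAction_neg (S : Matrix ι ι ℂ) (f : PiLp 2 fun _ : ι => E) :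
    matrixAction (-S) f = -matrixAction S f := by
  ext j
  simp [matrixAction_apply]

theorem matrixAction_matrixAction (S T : Matrix ι ι ℂ) (f : PiLp 2 fun _ : ι => E) :
    matrixAction S (matrixAction T f) = matrixAction (S * T) f := by
  ext j
  simp only [matrixAction_apply, Matrix.mul_apply, Finset.smul_sum, smul_smul, Finset.sum_smul]
  exact Finset.sum_comm

theorem diagonal_matrixAction (L : E →L[ℂ] F) (S : Matrix ι ι ℂ) (f : PiLp 2 fun _ : ι => E) :
    diagonal L (matrixAction S f) = matrixAction S (diagonal L f) := by
  ext j
  simp [diagonal_apply, matrixAction_apply]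

end NormedSpace

theorem inner_matrixAction_right [InnerProductSpace ℂ E] (S : Matrix ι ι ℂ)
    (f g : PiLp 2 fun _ : ι => E) :
    inner ℂ f (matrixAction S g) = inner ℂ (matrixAction Sᴴ f) g := by
  simp only [PiLp.inner_apply, matrixAction_apply, inner_sum, sum_inner, inner_smul_left,
    inner_smul_right, Matrix.conjTranspose_apply, Complex.star_def, Complex.conj_conj]
  exact Finset.sum_comm

theorem norm_matrixAction [DecidableEq ι] [InnerProductSpace ℂ E] {S : Matrix ι ι ℂ}
    (hS : Sᴴ * S = 1) (f : PiLp 2 fun _ : ι => E) : ‖matrixAction S f‖ = ‖f‖ := by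
  have hinner : inner ℂ (matrixAction S f) (matrixAction S f) = inner ℂ f f := by
    rw [inner_matrixAction_right, matrixAction_matrixAction, hS, matrixAction_one]
  simp only [inner_self_eq_norm_sq_to_K] at hinner
  exact (sq_eq_sq₀ (norm_nonneg _) (norm_nonneg _)).1 (by exact_mod_cast hinner)

end MatrixAction

/-! ### Multiplication by a phase -/

section Phase

variable {α : Type*} {m : α → ℝ}

/-- The multiplier `exp (i t m)` of the group generated by multiplication by `i m`. -/
def phase (m : α → ℝ) (t : ℝ) (x : α) : ℂ :=
  Complex.exp (Complex.I * ((t * m x : ℝ) : ℂ))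

theorem norm_phase (t : ℝ) (x : α) : ‖phase m t x‖ = 1 :=
  Complex.norm_exp_I_mul_ofReal _

theorem phase_zero (x : α) : phase m 0 x = 1 := by
  simp [phase]

theorem phase_add (s t : ℝ) (x : α) : phase m (s + t) x = phase m s x * phase m t x := by
  rw [phase, phase, phase, ← Complex.exp_add]
  push_cast
  ring_nf

theorem continuous_phase (x : α) : Continuous fun t => phase m t x := by
  unfold phase
  fun_prop

theorem tendsto_slope_phase (x : α) :
    Tendsto (fun t : ℝ => ((t⁻¹ : ℝ) : ℂ) * (phase m t x - 1)) (𝓝[≠] 0) (𝓝 (Complex.I * m x)) := by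
  have harg : HasDerivAt (fun t : ℝ => Complex.I * ((t * m x : ℝ) : ℂ)) (Complex.I * m x) 0 := by
    simpa using (((hasDerivAt_id (0 : ℝ)).mul_const (m x)).ofReal_comp).const_mul Complex.I
  have hexp : HasDerivAt (fun t => phase m t x) (Complex.I * m x) 0 := by
    simpa [phase] using harg.cexp
  simpa [phase_zero] using hexp.tendsto_slope_zero

theorem norm_slope_phase_le {t : ℝ} (ht : t ≠ 0) (x : α) :
    ‖((t⁻¹ : ℝ) : ℂ) * (phase m t x - 1)‖ ≤ ‖m x‖ := by
  rw [norm_mul, Complex.norm_real, norm_inv, inv_mul_le_iff₀ (norm_pos_iff.2 ht), ← norm_mul]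
  exact Real.norm_exp_I_mul_ofReal_sub_one_le

variable [MeasurableSpace α] {μ : Measure α}

theorem norm_sq_eq_integral_norm_sq (u : Lp ℂ 2 μ) : ‖u‖ ^ 2 = ∫ x, ‖u x‖ ^ 2 ∂μ := by
  rw [← inner_self_eq_norm_sq (𝕜 := ℂ), L2.inner_def, ← integral_re (L2.integrable_inner u u)]
  simp only [inner_self_eq_norm_sq]

theorem tendsto_L2_of_dominated {ι : Type*} {l : Filter ι} [l.IsCountablyGenerated]
    {F : ι → Lp ℂ 2 μ} {G : ι → α → ℂ} {f : Lp ℂ 2 μ} {b : α → ℝ} (hG : ∀ i, F i =ᵐ[μ] G i)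
    (hb : MemLp b 2 μ) (hbound : ∀ᶠ i in l, ∀ᵐ x ∂μ, ‖G i x - f x‖ ≤ b x)
    (hlim : ∀ᵐ x ∂μ, Tendsto (fun i => G i x) l (𝓝 (f x))) : Tendsto F l (𝓝 f) := by
  have hnorm : ∀ i, ∫ x, ‖G i x - f x‖ ^ 2 ∂μ = ‖F i - f‖ ^ 2 := fun i => by
    rw [norm_sq_eq_integral_norm_sq]
    refine integral_congr_ae ?_
    filter_upwards [hG i, Lp.coeFn_sub (F i) f] with x hx hsub
    rw [hsub, Pi.sub_apply, hx]
  have hint : Tendsto (fun i => ∫ x, ‖G i x - f x‖ ^ 2 ∂μ) l (𝓝 (∫ _, (0 : ℝ) ∂μ)) := by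
    refine tendsto_integral_filter_of_dominated_convergence (fun x => b x ^ 2)
      (Eventually.of_forall fun i => ?_) ?_ hb.integrable_sq ?_
    · exact (((Lp.aestronglyMeasurable (F i)).congr (hG i)).sub
        (Lp.aestronglyMeasurable f)).norm.pow 2
    · filter_upwards [hbound] with i hi
      filter_upwards [hi] with x hx
      rw [Real.norm_of_nonneg (by positivity)]
      gcongr
    · filter_upwards [hlim] with x hx
      simpa using ((hx.sub_const (f x)).norm).pow 2
  simp only [hnorm, integral_zero] at hint
  rw [tendsto_iff_norm_sub_tendsto_zero]
  simpa only [Real.sqrt_sq (norm_nonneg _), Real.sqrt_zero] using hint.sqrt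

theorem memLp_top_phase (hm : AEMeasurable m μ) (t : ℝ) : MemLp (phase m t) ⊤ μ :=
  memLp_top_of_bound (by unfold phase; fun_prop) 1
    (Eventually.of_forall fun x => (norm_phase t x).le)

/-- Multiplication by `exp (i t m)` on `L²`. -/
def phaseMul (hm : AEMeasurable m μ) (t : ℝ) : Lp ℂ 2 μ →L[ℂ] Lp ℂ 2 μ :=
  (ContinuousLinearMap.mul ℂ ℂ).holderL μ ⊤ 2 2 ((memLp_top_phase hm t).toLp (phase m t))

theorem coeFn_phaseMul (hm : AEMeasurable m μ) (t : ℝ) (f : Lp ℂ 2 μ) :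
    phaseMul hm t f =ᵐ[μ] fun x => phase m t x * f x := by
  filter_upwards [(ContinuousLinearMap.mul ℂ ℂ).coeFn_holder (r := 2)
    ((memLp_top_phase hm t).toLp (phase m t)) f, (memLp_top_phase hm t).coeFn_toLp] with x hx hphase
  rw [← hphase]
  exact hx

theorem isIsometryGroup_phaseMul (hm : AEMeasurable m μ) : IsIsometryGroup (phaseMul hm) where
  map_zero := by
    refine ContinuousLinearMap.ext fun f => Lp.ext ?_
    filter_upwards [coeFn_phaseMul hm 0 f] with x hx
    rw [hx, phase_zero, one_mul, one_apply_eq_self]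
  map_add s t := by
    refine ContinuousLinearMap.ext fun f => Lp.ext ?_
    filter_upwards [coeFn_phaseMul hm (s + t) f, coeFn_phaseMul hm t f,
      coeFn_phaseMul hm s (phaseMul hm t f)] with x hadd ht hs
    rw [mul_apply_eq_comp, hadd, hs, ht, phase_add, mul_assoc]
  norm_map t f := by
    rw [Lp.norm_def, Lp.norm_def]
    congr 1
    refine eLpNorm_congr_norm_ae ?_
    filter_upwards [coeFn_phaseMul hm t f] with x hx
    rw [hx, norm_mul, norm_phase, one_mul]
  continuous f := by
    refine continuous_iff_continuousAt.2 fun s =>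
      tendsto_L2_of_dominated (b := fun x => 2 * ‖f x‖) (fun t => coeFn_phaseMul hm t f)
        ((Lp.memLp f).norm.const_mul 2) (Eventually.of_forall fun t => ?_) ?_
    · filter_upwards [coeFn_phaseMul hm s f] with x hx
      rw [hx]
      refine (norm_sub_le _ _).trans_eq ?_
      rw [norm_mul, norm_mul, norm_phase, norm_phase]
      ring
    · filter_upwards [coeFn_phaseMul hm s f] with x hx
      rw [hx]
      exact ((continuous_phase x).tendsto s).mul_const (f x)

theorem coeFn_slope_phaseMul (hm : AEMeasurable m μ) (f : Lp ℂ 2 μ) (t : ℝ) :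
    (((t⁻¹ : ℝ) : ℂ) • (phaseMul hm t f - phaseMul hm 0 f) : Lp ℂ 2 μ) =ᵐ[μ]
      fun x => ((t⁻¹ : ℝ) : ℂ) * (phase m t x - 1) * f x := by
  rw [(isIsometryGroup_phaseMul hm).zero_apply]
  filter_upwards [coeFn_phaseMul hm t f, Lp.coeFn_sub (phaseMul hm t f) f,
    Lp.coeFn_smul ((t⁻¹ : ℝ) : ℂ) (phaseMul hm t f - f)] with x hmul hsub hsmul
  rw [hsmul, Pi.smul_apply, hsub, Pi.sub_apply, hmul, smul_eq_mul]
  ring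

theorem ae_eq_of_hasDerivAt_phaseMul (hm : AEMeasurable m μ) {f g : Lp ℂ 2 μ}
    (h : HasDerivAt (fun t => phaseMul hm t f) g 0) :
    g =ᵐ[μ] fun x => Complex.I * m x * f x := by
  obtain ⟨ns, hns, hae⟩ := (tendstoInMeasure_of_tendsto_Lp
    (hasDerivAt_zero_iff_tendsto_slope.1 h)).exists_seq_tendsto_ae'
  filter_upwards [hae, ae_all_iff.2 fun k => coeFn_slope_phaseMul hm f (ns k)] with x hlim hslope
  simp only [hslope] at hlim
  exact tendsto_nhds_unique hlim (((tendsto_slope_phase x).comp hns).mul_const (f x))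

theorem hasDerivAt_phaseMul (hm : AEMeasurable m μ) {f g : Lp ℂ 2 μ}
    (h : g =ᵐ[μ] fun x => Complex.I * m x * f x) :
    HasDerivAt (fun t => phaseMul hm t f) g 0 := by
  refine hasDerivAt_zero_iff_tendsto_slope.2 (tendsto_L2_of_dominated (b := fun x => 2 * ‖g x‖)
    (coeFn_slope_phaseMul hm f) ((Lp.memLp g).norm.const_mul 2) ?_ ?_)
  · filter_upwards [self_mem_nhdsWithin] with t ht
    filter_upwards [h] with x hx
    have hslope : ‖((t⁻¹ : ℝ) : ℂ) * (phase m t x - 1) * f x‖ ≤ ‖g x‖ := by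
      rw [hx, norm_mul, norm_mul (Complex.I * m x), norm_mul Complex.I, Complex.norm_I, one_mul,
        Complex.norm_real]
      gcongr
      exact norm_slope_phase_le ht x
    linarith [norm_sub_le (((t⁻¹ : ℝ) : ℂ) * (phase m t x - 1) * f x) (g x)]
  · filter_upwards [h] with x hx
    rw [hx]
    exact (tendsto_slope_phase x).mul_const (f x)

theorem hasDerivAt_phaseMul_iff (hm : AEMeasurable m μ) {f g : Lp ℂ 2 μ} :
    HasDerivAt (fun t => phaseMul hm t f) g 0 ↔ g =ᵐ[μ] fun x => Complex.I * m x * f x :=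
  ⟨ae_eq_of_hasDerivAt_phaseMul hm, hasDerivAt_phaseMul hm⟩

end Phase

/-! ### Weak derivatives and primitives -/

section Primitive

variable {E : Type*} [NormedAddCommGroup E] [NormedSpace ℝ E]

theorem integral_Ioi_eq_intervalIntegral {F : ℝ → E} {a b : ℝ} (hab : a ≤ b)
    (hF : ∀ x, b < x → F x = 0) : ∫ x in Ioi a, F x = ∫ x in a..b, F x := by
  rw [intervalIntegral.integral_of_le hab]
  exact setIntegral_eq_of_subset_of_forall_sdiff_eq_zero measurableSet_Ioi Ioc_subset_Ioi_self
    fun x hx => hF x (lt_of_not_ge fun hxb => hx.2 ⟨hx.1, hxb⟩)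

theorem exists_forall_lt_abs_eq_zero {F : Type*} [Zero F] {φ : ℝ → F} (hφ : HasCompactSupport φ) :
    ∃ R, ∀ x, R < |x| → φ x = 0 := by
  obtain ⟨R, hR⟩ := hφ.isCompact.isBounded.subset_closedBall 0
  refine ⟨R, fun x hx => image_eq_zero_of_notMem_tsupport fun hmem => hx.not_ge ?_⟩
  simpa using hR hmem

theorem intervalIntegrable_deriv_smul_primitive {φ : ℝ → ℝ} (hφ : ContDiff ℝ 1 φ) {g : ℝ → E}
    {a b : ℝ} (hg : IntervalIntegrable g volume a b) :
    IntervalIntegrable (fun x => deriv φ x • ∫ t in a..x, g t) volume a b :=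
  ((hφ.continuous_deriv le_rfl).continuousOn.smul
    (intervalIntegral.continuousOn_primitive_interval' hg left_mem_uIcc)).intervalIntegrable

theorem integral_deriv_mul_primitive {φ g : ℝ → ℝ} (hφ : ContDiff ℝ 1 φ) {a b : ℝ}
    (hg : IntervalIntegrable g volume a b) :
    ∫ x in a..b, deriv φ x * ∫ t in a..x, g t =
      φ b * (∫ t in a..b, g t) - ∫ x in a..b, φ x * g x := by
  have hparts := AbsolutelyContinuousOnInterval.integral_mul_deriv_eq_deriv_mul
    (hφ.contDiffOn.absolutelyContinuousOnInterval (a := a) (b := b))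
    (hg.absolutelyContinuousOnInterval_intervalIntegral (c := a) left_mem_uIcc)
  have hderiv : ∫ x in a..b, φ x * deriv (fun x => ∫ t in a..x, g t) x =
      ∫ x in a..b, φ x * g x := by
    refine intervalIntegral.integral_congr_ae ?_
    filter_upwards [hg.ae_hasDerivAt_integral] with x hx hmem
    rw [(hx (uIoc_subset_uIcc hmem) a left_mem_uIcc).deriv]
  rw [hderiv, intervalIntegral.integral_same, mul_zero, sub_zero] at hparts
  rw [hparts, sub_sub_cancel]

variable [CompleteSpace E]

/-- Reduces to scalar functions by testing against continuous linear functionals. -/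
theorem integral_deriv_smul_primitive {φ : ℝ → ℝ} (hφ : ContDiff ℝ 1 φ) {g : ℝ → E} {a b : ℝ}
    (hg : IntervalIntegrable g volume a b) :
    ∫ x in a..b, deriv φ x • ∫ t in a..x, g t =
      φ b • (∫ t in a..b, g t) - ∫ x in a..b, φ x • g x := by
  have hright : IntervalIntegrable (fun x => φ x • g x) volume a b :=
    hg.continuousOn_smul hφ.continuous.continuousOn
  refine (SeparatingDual.eq_iff_forall_dual_eq (R := ℝ)).2 fun ℓ => ?_
  have hprimitive : ∀ x ∈ uIcc a b, ℓ (∫ t in a..x, g t) = ∫ t in a..x, ℓ (g t) := fun x hx =>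
    (ℓ.intervalIntegral_comp_comm (hg.mono_set (uIcc_subset_uIcc_left hx))).symm
  have hscalar := integral_deriv_mul_primitive hφ (g := fun t => ℓ (g t)) (a := a) (b := b)
    ⟨ℓ.integrable_comp hg.1, ℓ.integrable_comp hg.2⟩
  rw [map_sub, map_smul,
    ← ℓ.intervalIntegral_comp_comm (intervalIntegrable_deriv_smul_primitive hφ hg),
    ← ℓ.intervalIntegral_comp_comm hright, hprimitive b right_mem_uIcc]
  simp only [map_smul, smul_eq_mul]
  rw [← hscalar]
  exact intervalIntegral.integral_congr fun x hx => by simp only [hprimitive x hx]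

theorem integral_Ioi_deriv_smul_primitive {φ : ℝ → ℝ} (hφ : ContDiff ℝ 1 φ)
    (hφc : HasCompactSupport φ) {g : ℝ → E} {a : ℝ}
    (hg : ∀ b, a ≤ b → IntervalIntegrable g volume a b) (c : E) :
    ∫ x in Ioi a, deriv φ x • (c + ∫ t in a..x, g t) =
      -(φ a • c) - ∫ x in Ioi a, φ x • g x := by
  obtain ⟨R, hR⟩ := exists_forall_lt_abs_eq_zero hφc
  obtain ⟨R', hR'⟩ := exists_forall_lt_abs_eq_zero hφc.deriv
  obtain ⟨b, hab, hRb, hRb'⟩ : ∃ b, a ≤ b ∧ R < b ∧ R' < b :=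
    ⟨max a (max R R' + 1), le_max_left _ _, lt_max_of_lt_right (by grind),
      lt_max_of_lt_right (by grind)⟩
  have hdφ : Continuous (deriv φ) := hφ.continuous_deriv le_rfl
  have hφb : φ b = 0 := hR b (hRb.trans_le (le_abs_self b))
  rw [integral_Ioi_eq_intervalIntegral hab fun x hx => by
      rw [hR' x (hRb'.trans (hx.trans_le (le_abs_self x))), zero_smul],
    integral_Ioi_eq_intervalIntegral hab fun x hx => by
      rw [hR x (hRb.trans (hx.trans_le (le_abs_self x))), zero_smul]]
  have hconst : IntervalIntegrable (fun x => deriv φ x • c) volume a b :=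
    (hdφ.smul continuous_const).intervalIntegrable a b
  simp only [smul_add]
  rw [intervalIntegral.integral_add hconst
      (intervalIntegrable_deriv_smul_primitive hφ (hg b hab)),
    integral_deriv_smul_primitive hφ (hg b hab), intervalIntegral.integral_smul_const,
    intervalIntegral.integral_deriv_eq_sub (fun x _ => (hφ.differentiable one_ne_zero) x)
      (hdφ.intervalIntegrable _ _), hφb, zero_sub, neg_smul, zero_smul, zero_sub, sub_eq_add_neg]

end Primitive

section WeakDeriv

theorem hasWeakDeriv_Ioi_primitive {g : ℝ → ℂ} {a : ℝ}
    (hg : ∀ b, a ≤ b → IntervalIntegrable g volume a b) (c : ℂ) :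
    HasWeakDeriv (Ioi a) (fun x => c + ∫ t in a..x, g t) g := by
  intro φ hφ hφc hφs
  have hφa : φ a = 0 := image_eq_zero_of_notMem_tsupport fun h => lt_irrefl a (hφs h)
  rw [integral_Ioi_deriv_smul_primitive (hφ.of_le (by simp)) hφc hg, hφa, zero_smul, neg_zero,
    zero_sub]

theorem hasWeakDeriv_univ_primitive {g : ℝ → ℂ} (hg : ∀ a b, IntervalIntegrable g volume a b)
    (a : ℝ) (c : ℂ) : HasWeakDeriv univ (fun x => c + ∫ t in a..x, g t) g := by
  intro φ hφ hφc _
  obtain ⟨R, hR⟩ := exists_forall_lt_abs_eq_zero hφc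
  obtain ⟨R', hR'⟩ := exists_forall_lt_abs_eq_zero hφc.deriv
  obtain ⟨p, hp⟩ : ∃ p, p < min (-R) (-R') := exists_lt _
  have hbelow : ∀ x, x ∉ Ioi p → R < |x| ∧ R' < |x| := fun x hx => by
    have := neg_le_abs x
    simp only [mem_Ioi, not_lt] at hx
    constructor <;> grind
  have hprim : (fun x => deriv φ x • (c + ∫ t in a..x, g t)) =
      fun x => deriv φ x • ((c + ∫ t in a..p, g t) + ∫ t in p..x, g t) := by
    funext x
    rw [add_assoc, intervalIntegral.integral_add_adjacent_intervals (hg a p) (hg p x)]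
  rw [hprim, setIntegral_univ, setIntegral_univ,
    ← setIntegral_eq_integral_of_forall_compl_eq_zero (s := Ioi p) (f := fun x => φ x • g x)
      fun x hx => by rw [hR x (hbelow x hx).1, zero_smul],
    ← setIntegral_eq_integral_of_forall_compl_eq_zero (s := Ioi p)
      fun x hx => by rw [hR' x (hbelow x hx).2, zero_smul],
    integral_Ioi_deriv_smul_primitive (hφ.of_le (by simp)) hφc fun b _ => hg p b,
    hR p (hbelow p self_notMem_Ioi).1, zero_smul, neg_zero, zero_sub]

/-- `φ` is a real test function on `Ω`: the functions against which `HasWeakDeriv Ω` tests. -/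
structure IsTestFunction (Ω : Set ℝ) (φ : ℝ → ℝ) : Prop where
  contDiff : ContDiff ℝ ∞ φ
  hasCompactSupport : HasCompactSupport φ
  tsupport_subset : tsupport φ ⊆ Ω

namespace IsTestFunction

variable {Ω : Set ℝ} {φ θ : ℝ → ℝ}

theorem integrable (hφ : IsTestFunction Ω φ) : Integrable φ :=
  hφ.contDiff.continuous.integrable_of_hasCompactSupport hφ.hasCompactSupport

theorem integrable_smul (hφ : IsTestFunction Ω φ) {μ : Measure ℝ} {u : ℝ → ℂ}
    (hu : LocallyIntegrable u μ) : Integrable (fun x => φ x • u x) μ :=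
  hu.integrable_smul_left_of_hasCompactSupport hφ.contDiff.continuous hφ.hasCompactSupport

theorem integrable_deriv_smul (hφ : IsTestFunction Ω φ) {μ : Measure ℝ} {u : ℝ → ℂ}
    (hu : LocallyIntegrable u μ) : Integrable (fun x => deriv φ x • u x) μ :=
  hu.integrable_smul_left_of_hasCompactSupport (hφ.contDiff.continuous_deriv (by simp))
    hφ.hasCompactSupport.deriv

theorem setIntegral_smul (hφ : IsTestFunction Ω φ) (u : ℝ → ℂ) :
    ∫ x in Ω, φ x • u x = ∫ x, φ x • u x :=
  setIntegral_eq_integral_of_forall_compl_eq_zero fun x hx => by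
    rw [image_eq_zero_of_notMem_tsupport fun hmem => hx (hφ.tsupport_subset hmem), zero_smul]

theorem exists_integral_eq_one (hΩ : IsOpen Ω) (hne : Ω.Nonempty) :
    ∃ θ, IsTestFunction Ω θ ∧ ∫ x, θ x = 1 := by
  obtain ⟨p, hp⟩ := hne
  obtain ⟨ε, hε, hball⟩ := Metric.nhds_basis_closedBall.mem_iff.1 (hΩ.mem_nhds hp)
  let θ : ContDiffBump p := ⟨ε / 2, ε, by positivity, by linarith⟩
  exact ⟨θ.normed volume, ⟨θ.contDiff_normed, θ.hasCompactSupport_normed,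
    θ.tsupport_normed_eq.trans_subset hball⟩, θ.integral_normed⟩

theorem exists_primitive (hΩ : OrdConnected Ω) (hφ : IsTestFunction Ω φ)
    (hmean : ∫ x, φ x = 0) : ∃ ψ, IsTestFunction Ω ψ ∧ deriv ψ = φ := by
  rcases (tsupport φ).eq_empty_or_nonempty with hempty | hne
  · obtain rfl : φ = 0 := tsupport_eq_empty_iff.1 hempty
    exact ⟨0, hφ, deriv_const' 0⟩
  obtain ⟨p, hp, hpmin⟩ := hφ.hasCompactSupport.isCompact.exists_isLeast hne
  obtain ⟨q, hq, hqmax⟩ := hφ.hasCompactSupport.isCompact.exists_isGreatest hne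
  let ψ : ℝ → ℝ := fun x => ∫ t in p - 1..x, φ t
  have hderiv : ∀ x, HasDerivAt ψ (φ x) x := fun x =>
    (hφ.contDiff.continuous.integral_hasStrictDerivAt _ x).hasDerivAt
  have hψ' : deriv ψ = φ := funext fun x => (hderiv x).deriv
  have hsupport : ∀ x, x ∉ Icc p q → ψ x = 0 := by
    intro x hx
    by_cases hxp : x < p
    · refine intervalIntegral.integral_zero_ae (Eventually.of_forall fun t ht => ?_)
      refine image_eq_zero_of_notMem_tsupport fun hmem => ?_
      have := hpmin hmem
      grind [uIoc]
    · rw [← hmean]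
      refine intervalIntegral.integral_eq_integral_of_support_subset fun t ht => ?_
      have := hpmin (subset_tsupport φ ht)
      have := hqmax (subset_tsupport φ ht)
      grind
  have hts : tsupport ψ ⊆ Icc p q :=
    closure_minimal (fun x hx => by_contra fun hnot => hx (hsupport x hnot)) isClosed_Icc
  refine ⟨ψ, ⟨contDiff_infty_iff_deriv.2 ⟨fun x => (hderiv x).differentiableAt, ?_⟩,
    isCompact_Icc.of_isClosed_subset (isClosed_tsupport ψ) hts,
    hts.trans (hΩ.out (hφ.tsupport_subset hp) (hφ.tsupport_subset hq))⟩, hψ'⟩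
  rw [hψ']
  exact hφ.contDiff

theorem sub_const_mul (hφ : IsTestFunction Ω φ) (hθ : IsTestFunction Ω θ) (r : ℝ) :
    IsTestFunction Ω fun x => φ x - r * θ x := by
  have hts : tsupport (fun x => φ x - r * θ x) ⊆ tsupport φ ∪ tsupport θ := by
    refine closure_minimal (fun x hx => by_contra fun hnot => hx ?_)
      ((isClosed_tsupport φ).union (isClosed_tsupport θ))
    rw [mem_union, not_or] at hnot
    simp only [image_eq_zero_of_notMem_tsupport hnot.1, image_eq_zero_of_notMem_tsupport hnot.2,
      mul_zero, sub_zero]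
  exact ⟨hφ.contDiff.sub (contDiff_const.mul hθ.contDiff),
    (hφ.hasCompactSupport.isCompact.union hθ.hasCompactSupport.isCompact).of_isClosed_subset
      (isClosed_tsupport _) hts,
    hts.trans (union_subset hφ.tsupport_subset hθ.tsupport_subset)⟩

theorem exists_deriv_eq_sub (hΩ : OrdConnected Ω) (hφ : IsTestFunction Ω φ)
    (hθ : IsTestFunction Ω θ) (hθ1 : ∫ x, θ x = 1) :
    ∃ ψ, IsTestFunction Ω ψ ∧ deriv ψ = fun x => φ x - (∫ t, φ t) * θ x := by
  refine (hφ.sub_const_mul hθ _).exists_primitive hΩ ?_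
  rw [integral_sub hφ.integrable (hθ.integrable.const_mul _), integral_const_mul, hθ1, mul_one,
    sub_self]

end IsTestFunction

theorem HasWeakDeriv.setIntegral_deriv_smul {Ω : Set ℝ} {f g : ℝ → ℂ} (h : HasWeakDeriv Ω f g)
    {φ : ℝ → ℝ} (hφ : IsTestFunction Ω φ) :
    ∫ x in Ω, deriv φ x • f x = -∫ x in Ω, φ x • g x :=
  h φ hφ.contDiff hφ.hasCompactSupport hφ.tsupport_subset

/-- The lemma of du Bois-Reymond. -/
theorem HasWeakDeriv.exists_ae_eq_const {Ω : Set ℝ} (hΩ : IsOpen Ω) (hΩc : OrdConnected Ω)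
    {u : ℝ → ℂ} (hu : LocallyIntegrable u (volume.restrict Ω)) (h : HasWeakDeriv Ω u 0) :
    ∃ c, u =ᵐ[volume.restrict Ω] fun _ => c := by
  rcases Ω.eq_empty_or_nonempty with rfl | hne
  · exact ⟨0, by simp [EventuallyEq]⟩
  obtain ⟨θ, hθ, hθ1⟩ := IsTestFunction.exists_integral_eq_one hΩ hne
  refine ⟨∫ x in Ω, θ x • u x, ?_⟩
  set c := ∫ x in Ω, θ x • u x
  have hpair : ∀ φ, IsTestFunction Ω φ → ∫ x in Ω, φ x • u x = (∫ x, φ x) • c := by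
    intro φ hφ
    obtain ⟨ψ, hψ, hψ'⟩ := hφ.exists_deriv_eq_sub hΩc hθ hθ1
    have hweak := h.setIntegral_deriv_smul hψ
    simp only [hψ', sub_smul, mul_smul, Pi.zero_apply, smul_zero, integral_zero,
      neg_zero] at hweak
    rw [integral_sub (hφ.integrable_smul hu) ((hθ.integrable_smul hu).fun_smul (∫ t, φ t)),
      integral_smul] at hweak
    exact sub_eq_zero.1 hweak
  have hzero := hΩ.ae_eq_zero_of_integral_contDiff_smul_eq_zero
    (locallyIntegrableOn_of_locallyIntegrable_restrict (hu.sub (locallyIntegrable_const c)))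
    fun φ h₁ h₂ h₃ => by
      have hφ : IsTestFunction Ω φ := ⟨h₁, h₂, h₃⟩
      rw [← hφ.setIntegral_smul]
      simp only [Pi.sub_apply, smul_sub]
      rw [integral_sub (hφ.integrable_smul hu) (hφ.integrable.restrict.smul_const c), hpair φ hφ,
        hφ.setIntegral_smul fun _ => c, integral_smul_const, sub_self]
  filter_upwards [(ae_restrict_iff' hΩ.measurableSet).2 hzero] with x hx
  exact sub_eq_zero.1 hx

theorem HasWeakDeriv.exists_ae_eq_add_const {Ω : Set ℝ} (hΩ : IsOpen Ω) (hΩc : OrdConnected Ω)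
    {f₁ f₂ g : ℝ → ℂ} (hf₁ : LocallyIntegrable f₁ (volume.restrict Ω))
    (hf₂ : LocallyIntegrable f₂ (volume.restrict Ω)) (h₁ : HasWeakDeriv Ω f₁ g)
    (h₂ : HasWeakDeriv Ω f₂ g) : ∃ c, f₁ =ᵐ[volume.restrict Ω] fun x => c + f₂ x := by
  have hdiff : HasWeakDeriv Ω (f₁ - f₂) 0 := by
    intro φ k₁ k₂ k₃
    have hφ : IsTestFunction Ω φ := ⟨k₁, k₂, k₃⟩
    simp only [Pi.sub_apply, smul_sub, Pi.zero_apply, smul_zero, integral_zero, neg_zero]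
    rw [integral_sub (hφ.integrable_deriv_smul hf₁) (hφ.integrable_deriv_smul hf₂),
      h₁.setIntegral_deriv_smul hφ, h₂.setIntegral_deriv_smul hφ, sub_self]
  obtain ⟨c, hc⟩ := hdiff.exists_ae_eq_const hΩ hΩc (hf₁.sub hf₂)
  exact ⟨c, hc.mono fun x hx => sub_eq_iff_eq_add.1 hx⟩

end WeakDeriv

section SchwartzTest

theorem integral_smul_eq_re_add_im {φ u : ℝ → ℂ} (hφ : Continuous φ) (hφc : HasCompactSupport φ)
    (hu : LocallyIntegrable u) :
    ∫ x, φ x • u x = (∫ x, (φ x).re • u x) + Complex.I • ∫ x, (φ x).im • u x := by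
  rw [← integral_smul, ← integral_add]
  · refine integral_congr_ae (Eventually.of_forall fun x => ?_)
    simp only [smul_eq_mul, Complex.real_smul]
    linear_combination (-u x) * Complex.re_add_im (φ x)
  · exact hu.integrable_smul_left_of_hasCompactSupport (Complex.continuous_re.comp hφ)
      (hφc.comp_left Complex.zero_re)
  · exact (hu.integrable_smul_left_of_hasCompactSupport (Complex.continuous_im.comp hφ)
      (hφc.comp_left Complex.zero_im)).fun_smul Complex.I

theorem HasWeakDeriv.integral_deriv_smul_complex {f g : ℝ → ℂ} (h : HasWeakDeriv univ f g)
    (hf : LocallyIntegrable f) (hg : LocallyIntegrable g) {φ : ℝ → ℂ} (hφ : ContDiff ℝ ∞ φ)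
    (hφc : HasCompactSupport φ) : ∫ x, deriv φ x • f x = -∫ x, φ x • g x := by
  have hφ' : ∀ x, HasDerivAt φ (deriv φ x) x := fun x =>
    (hφ.differentiable (by simp) x).hasDerivAt
  have hre' : ∀ x, deriv (fun x => (φ x).re) x = (deriv φ x).re := fun x =>
    (Complex.reCLM.hasFDerivAt.comp_hasDerivAt x (hφ' x)).deriv
  have him' : ∀ x, deriv (fun x => (φ x).im) x = (deriv φ x).im := fun x =>
    (Complex.imCLM.hasFDerivAt.comp_hasDerivAt x (hφ' x)).deriv
  have hre := h (fun x => (φ x).re) (Complex.reCLM.contDiff.comp hφ)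
    (hφc.comp_left Complex.zero_re) (subset_univ _)
  have him := h (fun x => (φ x).im) (Complex.imCLM.contDiff.comp hφ)
    (hφc.comp_left Complex.zero_im) (subset_univ _)
  simp only [Measure.restrict_univ, hre', him'] at hre him
  rw [integral_smul_eq_re_add_im (hφ.continuous_deriv (by simp)) hφc.deriv hf,
    integral_smul_eq_re_add_im hφ.continuous hφc hg, hre, him, smul_neg, neg_add]

theorem continuous_integral_cutoff {χ : ℝ → ℝ} (hχ : Continuous χ) (hχc : HasCompactSupport χ)
    {u : ℝ → ℂ} (hu : Integrable u) : Continuous fun ε : ℝ => ∫ x, χ (ε * x) • u x := by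
  obtain ⟨C, hC⟩ := hχc.exists_bound_of_continuous hχ
  refine continuous_of_dominated (bound := fun x => C * ‖u x‖) (fun ε => ?_) (fun ε => ?_)
    (hu.norm.const_mul C) (Eventually.of_forall fun x => by fun_prop)
  · exact (by fun_prop : Continuous fun x => χ (ε * x)).aestronglyMeasurable.smul hu.1
  · refine Eventually.of_forall fun x => ?_
    rw [norm_smul]
    exact mul_le_mul_of_nonneg_right (hC _) (norm_nonneg _)

theorem integrable_schwartz_smul (φ : 𝓢(ℝ, ℂ)) {u : ℝ → ℂ} (hu : MemLp u 2) :
    Integrable fun x => φ x • u x :=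
  (φ.memLp 2 volume).integrable_mul hu

theorem HasWeakDeriv.integral_cutoff_deriv_smul {f g : ℝ → ℂ} (h : HasWeakDeriv univ f g)
    (hf : MemLp f 2) (hg : MemLp g 2) {χ : ℝ → ℝ} (hχ : ContDiff ℝ ∞ χ)
    (hχc : HasCompactSupport χ) (φ : 𝓢(ℝ, ℂ)) {ε : ℝ} (hε : ε ≠ 0) :
    ε • (∫ x, deriv χ (ε * x) • φ x • f x) + ∫ x, χ (ε * x) • deriv φ x • f x =
      -∫ x, χ (ε * x) • φ x • g x := by
  have hderiv : ∀ x, deriv (fun x => χ (ε * x) • φ x) x =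
      ε • deriv χ (ε * x) • φ x + χ (ε * x) • deriv φ x := by
    intro x
    have hscale : HasDerivAt (fun x => χ (ε * x)) (deriv χ (ε * x) * ε) x :=
      (hχ.differentiable (by simp) (ε * x)).hasDerivAt.comp x
        (by simpa using (hasDerivAt_id x).const_mul ε)
    rw [(hscale.fun_smul φ.differentiableAt.hasDerivAt).deriv, add_comm, mul_comm _ ε, mul_smul]
  have hscalec : HasCompactSupport fun x => χ (ε * x) :=
    hχc.comp_homeomorph (Homeomorph.mulLeft₀ ε hε)
  have hscalec' : HasCompactSupport fun x => deriv χ (ε * x) :=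
    hχc.deriv.comp_homeomorph (Homeomorph.mulLeft₀ ε hε)
  have hχ' : Continuous (deriv χ) := hχ.continuous_deriv (by simp)
  have hφf : Integrable fun x => φ x • f x := integrable_schwartz_smul φ hf
  have hφ'f : Integrable fun x => deriv φ x • f x :=
    integrable_schwartz_smul (SchwartzMap.derivCLM ℂ ℂ φ) hf
  have htest := h.integral_deriv_smul_complex (hf.locallyIntegrable (by norm_num))
    (hg.locallyIntegrable (by norm_num)) (φ := fun x => χ (ε * x) • φ x)
    ((hχ.comp (by fun_prop)).smul (φ.smooth ⊤)) hscalec.smul_right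
  simp only [hderiv, add_smul, smul_assoc] at htest
  rw [← htest, integral_add, integral_smul]
  · exact (hφf.locallyIntegrable.integrable_smul_left_of_hasCompactSupport (by fun_prop)
      hscalec').fun_smul ε
  · exact hφ'f.locallyIntegrable.integrable_smul_left_of_hasCompactSupport (by fun_prop) hscalec

/-- Multiply the Schwartz function by the cutoff `χ (ε x)` and let `ε → 0`. -/
theorem HasWeakDeriv.integral_deriv_smul_schwartz {f g : ℝ → ℂ} (h : HasWeakDeriv univ f g)
    (hf : MemLp f 2) (hg : MemLp g 2) (φ : 𝓢(ℝ, ℂ)) :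
    ∫ x, deriv φ x • f x = -∫ x, φ x • g x := by
  let χ : ContDiffBump (0 : ℝ) := ⟨1, 2, one_pos, one_lt_two⟩
  have hχ : ContDiff ℝ ∞ χ := χ.contDiff
  have hχc : HasCompactSupport χ := χ.hasCompactSupport
  have hχ0 : χ 0 = 1 := χ.one_of_mem_closedBall (by simp [χ])
  have hleft : Continuous fun ε : ℝ =>
      ε • (∫ x, deriv χ (ε * x) • φ x • f x) + ∫ x, χ (ε * x) • deriv φ x • f x :=
    (continuous_id.smul
      (continuous_integral_cutoff (hχ.continuous_deriv (by simp)) hχc.deriv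
        (integrable_schwartz_smul φ hf))).add
      (continuous_integral_cutoff hχ.continuous hχc
        (integrable_schwartz_smul (SchwartzMap.derivCLM ℂ ℂ φ) hf))
  have hright := (continuous_integral_cutoff hχ.continuous hχc
    (integrable_schwartz_smul φ hg)).neg
  have heq := hleft.ext_on (dense_compl_singleton 0) hright fun ε hε =>
    h.integral_cutoff_deriv_smul hf hg hχ hχc φ hε
  simpa [hχ0] using congr_fun heq 0

end SchwartzTest

/-! ### The Fourier transform of a weak derivative -/

section Fourier

open Complex (I)

theorem lineDerivOp_toTemperedDistribution_apply (f : L2Line) (φ : 𝓢(ℝ, ℂ)) :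
    (∂_{(1 : ℝ)} (f : 𝓢'(ℝ, ℂ))) φ = -∫ x, deriv φ x • f x := by
  rw [TemperedDistribution.lineDerivOp_apply_apply, map_neg, Lp.toTemperedDistribution_apply]
  simp only [SchwartzMap.lineDerivOp_apply_eq_fderiv, fderiv_apply_one_eq_deriv]

theorem integral_toSchwartzMap_smul {φ : ℝ → ℝ} (hφ : HasCompactSupport (Complex.ofRealCLM ∘ φ))
    (hφs : ContDiff ℝ ∞ (Complex.ofRealCLM ∘ φ)) (u : ℝ → ℂ) :
    ∫ x, hφ.toSchwartzMap hφs x • u x = ∫ x, φ x • u x := by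
  simp

theorem hasWeakDeriv_iff_lineDerivOp {f g : L2Line} :
    HasWeakDeriv univ f g ↔ ∂_{(1 : ℝ)} (f : 𝓢'(ℝ, ℂ)) = (g : 𝓢'(ℝ, ℂ)) := by
  constructor
  · intro h
    ext φ
    rw [lineDerivOp_toTemperedDistribution_apply,
      h.integral_deriv_smul_schwartz (Lp.memLp f) (Lp.memLp g), neg_neg,
      Lp.toTemperedDistribution_apply]
  · intro h φ hφ hφc _
    have hc : HasCompactSupport (Complex.ofRealCLM ∘ φ) := hφc.comp_left rfl
    have hs : ContDiff ℝ ∞ (Complex.ofRealCLM ∘ φ) := Complex.ofRealCLM.contDiff.comp hφ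
    have hderiv : ∀ x, deriv (hc.toSchwartzMap hs) x = deriv φ x := fun x =>
      (hφ.differentiable (by simp) x).hasDerivAt.ofReal_comp.deriv
    have htest := DFunLike.congr_fun h (hc.toSchwartzMap hs)
    rw [lineDerivOp_toTemperedDistribution_apply, Lp.toTemperedDistribution_apply,
      integral_toSchwartzMap_smul] at htest
    simp only [hderiv, Complex.coe_smul] at htest
    rw [Measure.restrict_univ, ← htest, neg_neg]

theorem ae_eq_of_forall_integral_schwartz_smul_eq {u w : ℝ → ℂ} (hu : LocallyIntegrable u)
    (hw : LocallyIntegrable w) (h : ∀ φ : 𝓢(ℝ, ℂ), ∫ x, φ x • u x = ∫ x, φ x • w x) :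
    u =ᵐ[volume] w := by
  refine ae_eq_of_integral_contDiff_smul_eq hu hw fun φ hφ hφc => ?_
  have hc : HasCompactSupport (Complex.ofRealCLM ∘ φ) := hφc.comp_left rfl
  have hs : ContDiff ℝ ∞ (Complex.ofRealCLM ∘ φ) := Complex.ofRealCLM.contDiff.comp hφ
  simpa only [integral_toSchwartzMap_smul] using h (hc.toSchwartzMap hs)

/-- The wave number `2πξ` of the Fourier mode `x ↦ exp (2πiξx)`. -/
def waveNumber (ξ : ℝ) : ℝ := 2 * Real.pi * ξ

theorem continuous_waveNumber : Continuous waveNumber := by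
  unfold waveNumber
  fun_prop

theorem fourier_lineDerivOp_apply (f : L2Line) (φ : 𝓢(ℝ, ℂ)) :
    𝓕 (∂_{(1 : ℝ)} (f : 𝓢'(ℝ, ℂ))) φ =
      ∫ ξ, φ ξ • (I * waveNumber ξ * (𝓕 f : L2Line) ξ) := by
  have hgrowth : (fun x : ℝ => ((inner ℝ x (1 : ℝ) : ℝ) : ℂ)).HasTemperateGrowth := by fun_prop
  rw [TemperedDistribution.fourier_lineDerivOp_eq, Lp.fourier_toTemperedDistribution_eq,
    smul_apply, TemperedDistribution.smulLeftCLM_apply_apply, Lp.toTemperedDistribution_apply,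
    ← integral_smul]
  refine integral_congr_ae (Eventually.of_forall fun ξ => ?_)
  simp only [SchwartzMap.smulLeftCLM_apply_apply hgrowth]
  simp only [RCLike.inner_apply, conj_trivial, one_mul, smul_eq_mul, waveNumber]
  push_cast
  ring

theorem hasWeakDeriv_iff_fourier {f g : L2Line} :
    HasWeakDeriv univ f g ↔
      (𝓕 g : L2Line) =ᵐ[volume] fun ξ => I * waveNumber ξ * (𝓕 f : L2Line) ξ := by
  have hfourier : HasWeakDeriv univ f g ↔ ∀ φ : 𝓢(ℝ, ℂ),
      ∫ ξ, φ ξ • (I * waveNumber ξ * (𝓕 f : L2Line) ξ) = ∫ ξ, φ ξ • (𝓕 g : L2Line) ξ := by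
    rw [hasWeakDeriv_iff_lineDerivOp,
      ← (FourierTransform.fourierEquiv ℂ 𝓢'(ℝ, ℂ)).injective.eq_iff,
      FourierTransform.fourierEquiv_apply, FourierTransform.fourierEquiv_apply,
      Lp.fourier_toTemperedDistribution_eq, DFunLike.ext_iff]
    simp only [fourier_lineDerivOp_apply, Lp.toTemperedDistribution_apply]
  rw [hfourier]
  constructor
  · intro h
    refine (ae_eq_of_forall_integral_schwartz_smul_eq ?_ ?_ h).symm
    · exact ((Lp.memLp (𝓕 f : L2Line)).locallyIntegrable (by norm_num)).continuous_mul
        (by have := continuous_waveNumber; fun_prop)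
    · exact (Lp.memLp (𝓕 g : L2Line)).locallyIntegrable (by norm_num)
  · intro h φ
    exact integral_congr_ae (h.mono fun ξ hξ => by simp only [hξ])

end Fourier

/-! ### The free group on the line -/

section FreeGroup

open Complex (I)

/-- The symbol of the Laplacian under the Fourier transform. -/
def laplacianSymbol (ξ : ℝ) : ℝ := -waveNumber ξ ^ 2

theorem continuous_laplacianSymbol : Continuous laplacianSymbol :=
  (continuous_waveNumber.pow 2).neg

theorem I_mul_waveNumber_mul_self (ξ : ℝ) :
    (I * waveNumber ξ) * (I * waveNumber ξ) = laplacianSymbol ξ := by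
  rw [laplacianSymbol]
  push_cast
  linear_combination (waveNumber ξ : ℂ) ^ 2 * Complex.I_mul_I

theorem memLp_mul_of_memLp_mul_mul {α : Type*} [MeasurableSpace α] {μ : Measure α} {p : ENNReal}
    {m f : α → ℂ} (hm : AEStronglyMeasurable m μ) (hf : MemLp f p μ)
    (hmmf : MemLp (fun x => m x * m x * f x) p μ) : MemLp (fun x => m x * f x) p μ := by
  refine (hf.norm.add hmmf.norm).mono (hm.mul hf.1) (Eventually.of_forall fun x => ?_)
  rw [Pi.add_apply, norm_mul, norm_mul, norm_mul, Real.norm_of_nonneg (by positivity)]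
  nlinarith [mul_nonneg (norm_nonneg (f x)) (sq_nonneg (‖m x‖ - 1)),
    mul_nonneg (norm_nonneg (f x)) (sq_nonneg ‖m x‖), norm_nonneg (f x)]

theorem fourier_fourierInv_L2 (u : L2Line) : (𝓕 (𝓕⁻ u : L2Line) : L2Line) = u :=
  FourierTransform.fourier_fourierInv_eq u

theorem mem_laplacianLineGraph_iff {f h : L2Line} :
    (f, h) ∈ laplacianLineGraph ↔
      (𝓕 h : L2Line) =ᵐ[volume] fun ξ => laplacianSymbol ξ * (𝓕 f : L2Line) ξ := by
  simp only [← I_mul_waveNumber_mul_self]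
  constructor
  · rintro ⟨f', hff', hf'h⟩
    filter_upwards [hasWeakDeriv_iff_fourier.1 hff', hasWeakDeriv_iff_fourier.1 hf'h] with ξ h₁ h₂
    rw [h₂, h₁, ← mul_assoc]
  · intro hfh
    have hmem : MemLp (fun ξ => I * waveNumber ξ * (𝓕 f : L2Line) ξ) 2 :=
      memLp_mul_of_memLp_mul_mul
        (by have := continuous_waveNumber; fun_prop : Continuous _).aestronglyMeasurable
        (Lp.memLp _) ((Lp.memLp (𝓕 h : L2Line)).ae_eq hfh)
    refine ⟨𝓕⁻ (hmem.toLp _), hasWeakDeriv_iff_fourier.2 ?_, hasWeakDeriv_iff_fourier.2 ?_⟩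
    · rw [fourier_fourierInv_L2]
      exact hmem.coeFn_toLp
    · rw [fourier_fourierInv_L2]
      filter_upwards [hfh, hmem.coeFn_toLp] with ξ h₁ h₂
      rw [h₁, h₂, mul_assoc]

theorem mem_smul_graph_iff {E : Type*} [AddCommGroup E] [Module ℂ E] {T : E →ₗ.[ℂ] E} {c : ℂ}
    (hc : c ≠ 0) {f g : E} : (f, g) ∈ (c • T).graph ↔ (f, c⁻¹ • g) ∈ T.graph := by
  rw [LinearPMap.smul_graph, Submodule.mem_map]
  constructor
  · rintro ⟨⟨a, b⟩, hab, h⟩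
    obtain ⟨rfl, rfl⟩ := Prod.mk.inj h
    simpa [smul_smul, hc] using hab
  · intro h
    exact ⟨_, h, by simp [smul_smul, hc]⟩

/-- The Fourier multiplier with symbol `exp (i t m(ξ))`, for `m` the symbol of the Laplacian. -/
def freeMultiplier (t : ℝ) : L2Line →L[ℂ] L2Line :=
  FourierTransform.fourierInvCLM ℂ L2Line ∘L
    phaseMul continuous_laplacianSymbol.aemeasurable t ∘L FourierTransform.fourierCLM ℂ L2Line

theorem fourier_freeMultiplier (t : ℝ) (f : L2Line) :
    (𝓕 (freeMultiplier t f) : L2Line) =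
      phaseMul continuous_laplacianSymbol.aemeasurable t (𝓕 f : L2Line) :=
  fourier_fourierInv_L2 _

theorem isGroupGeneratedBy_freeMultiplier :
    IsGroupGeneratedBy freeMultiplier (I • laplacianLine) := by
  have hinv : ∀ f : L2Line, (𝓕⁻ (𝓕 f : L2Line) : L2Line) = f :=
    FourierTransform.fourierInv_fourier_eq
  have hgroup : IsIsometryGroup freeMultiplier :=
    (isIsometryGroup_phaseMul _).pullback one_ne_zero
      (fun f => ((Lp.fourierTransformₗᵢ ℝ ℂ).norm_map f).trans (one_mul _).symm) hinv
      fun _ _ => fourier_fourierInv_L2 _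
  refine hgroup.isGroupGeneratedBy fun f g => ?_
  have hpull : HasDerivAt (fun t => freeMultiplier t f) g 0 ↔ HasDerivAt
      (fun t => phaseMul continuous_laplacianSymbol.aemeasurable t (𝓕 f : L2Line))
      (𝓕 g : L2Line) 0 :=
    hasDerivAt_pullback_iff (J := FourierTransform.fourierCLM ℂ L2Line)
      (P := FourierTransform.fourierInvCLM ℂ L2Line) hinv fun _ => fourier_fourierInv_L2 _
  refine Iff.trans ?_ hpull.symm
  rw [hasDerivAt_phaseMul_iff, mem_smul_graph_iff Complex.I_ne_zero, laplacianLine_graph,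
    mem_laplacianLineGraph_iff, FourierTransform.fourier_smul]
  have hsmul := Lp.coeFn_smul I⁻¹ (𝓕 g : L2Line)
  constructor <;> intro h <;> filter_upwards [h, hsmul] with ξ hξ hsmulξ
  · rwa [hsmulξ, Pi.smul_apply, smul_eq_mul, inv_mul_eq_iff_eq_mul₀ Complex.I_ne_zero,
      ← mul_assoc] at hξ
  · rw [hsmulξ, Pi.smul_apply, smul_eq_mul, inv_mul_eq_iff_eq_mul₀ Complex.I_ne_zero, hξ, mul_assoc]

theorem freeGroup_eq : freeGroup = freeMultiplier :=
  isGroupGeneratedBy_freeMultiplier.expGroup_eq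

theorem isGroupGeneratedBy_freeGroup : IsGroupGeneratedBy freeGroup (I • laplacianLine) :=
  freeGroup_eq ▸ isGroupGeneratedBy_freeMultiplier

theorem HasWeakDeriv.freeGroup {f g : L2Line} (h : HasWeakDeriv univ f g) (t : ℝ) :
    HasWeakDeriv univ (freeGroup t f) (freeGroup t g) := by
  rw [hasWeakDeriv_iff_fourier] at h ⊢
  rw [freeGroup_eq, fourier_freeMultiplier, fourier_freeMultiplier]
  filter_upwards [h, coeFn_phaseMul continuous_laplacianSymbol.aemeasurable t (𝓕 f : L2Line),
    coeFn_phaseMul continuous_laplacianSymbol.aemeasurable t (𝓕 g : L2Line)] with ξ h₁ h₂ h₃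
  rw [h₃, h₂, h₁, mul_left_comm]

theorem ae_laplacianSymbol_ne (c : ℂ) : ∀ᵐ ξ : ℝ, (laplacianSymbol ξ : ℂ) ≠ c := by
  have hsub : {ξ : ℝ | (laplacianSymbol ξ : ℂ) = c}.Finite := by
    rcases Set.eq_empty_or_nonempty {ξ : ℝ | (laplacianSymbol ξ : ℂ) = c} with hempty | ⟨ξ₀, hξ₀⟩
    · rw [hempty]
      exact finite_empty
    · refine (toFinite {ξ₀, -ξ₀}).subset fun ξ hξ => ?_
      have heq : laplacianSymbol ξ = laplacianSymbol ξ₀ :=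
        Complex.ofReal_injective (hξ.trans hξ₀.symm)
      simp only [laplacianSymbol, waveNumber, neg_inj, mul_pow] at heq
      exact sq_eq_sq_iff_eq_or_eq_neg.1 (mul_left_cancel₀ (by positivity) heq)
  rw [ae_iff]
  simpa only [not_not] using hsub.measure_zero volume

theorem eq_zero_of_mem_laplacianLineGraph {f : L2Line} {c : ℂ}
    (h : (f, c • f) ∈ laplacianLineGraph) : f = 0 := by
  rw [mem_laplacianLineGraph_iff, FourierTransform.fourier_smul] at h
  refine (Lp.fourierTransformₗᵢ ℝ ℂ).map_eq_zero_iff.1 (Lp.ext ?_)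
  filter_upwards [h, Lp.coeFn_smul c (𝓕 f : L2Line), ae_laplacianSymbol_ne c,
    Lp.coeFn_zero ℂ 2 volume] with ξ hξ hsmul hne hzero
  rw [hsmul, Pi.smul_apply, smul_eq_mul] at hξ
  rw [hzero, Pi.zero_apply]
  exact (mul_eq_mul_right_iff.1 hξ).resolve_left hne.symm

end FreeGroup

/-! ### Boundary values -/

section BoundaryValue

theorem HasWeakDeriv.mono {Ω Ω' : Set ℝ} {f g : ℝ → ℂ} (h : HasWeakDeriv Ω f g) (hΩ : Ω' ⊆ Ω) :
    HasWeakDeriv Ω' f g := by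
  intro φ hφ hφc hφs
  have hφs' : tsupport (deriv φ) ⊆ Ω' := tsupport_deriv_subset.trans hφs
  have hint : ∀ {ψ : ℝ → ℝ} {u : ℝ → ℂ} {s : Set ℝ}, tsupport ψ ⊆ s →
      ∫ x in s, ψ x • u x = ∫ x, ψ x • u x := fun hψ =>
    setIntegral_eq_integral_of_forall_compl_eq_zero fun x hx => by
      rw [image_eq_zero_of_notMem_tsupport fun hx' => hx (hψ hx'), zero_smul]
  rw [hint hφs', hint hφs, ← hint (hφs'.trans hΩ), ← hint (hφs.trans hΩ)]
  exact h φ hφ hφc (hφs.trans hΩ)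

theorem HasWeakDeriv.exists_continuous_ae_eq {f g : ℝ → ℂ} (hf : LocallyIntegrable f)
    (hg : LocallyIntegrable g) (h : HasWeakDeriv univ f g) :
    ∃ F, Continuous F ∧ f =ᵐ[volume] F := by
  have hgi : ∀ a b, IntervalIntegrable g volume a b := fun a b =>
    (hg.integrableOn_isCompact isCompact_uIcc).intervalIntegrable
  have hprim : Continuous fun x => 0 + ∫ t in (0 : ℝ)..x, g t :=
    continuous_const.add (intervalIntegral.continuous_primitive hgi 0)
  obtain ⟨c, hc⟩ := HasWeakDeriv.exists_ae_eq_add_const isOpen_univ ordConnected_univ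
    (by rwa [Measure.restrict_univ]) (by rw [Measure.restrict_univ]; exact hprim.locallyIntegrable)
    h (hasWeakDeriv_univ_primitive hgi 0 0)
  exact ⟨_, continuous_const.add hprim, by rwa [Measure.restrict_univ] at hc⟩

theorem eq_of_ae_eq_of_tendsto_nhdsGT {E : Type*} [TopologicalSpace E] [T2Space E] {a : ℝ}
    {F G : ℝ → E} {b c : E} (h : F =ᵐ[volume.restrict (Ioi a)] G) (hF : Tendsto F (𝓝[>] a) (𝓝 b))
    (hG : Tendsto G (𝓝[>] a) (𝓝 c)) : b = c := by
  refine tendsto_nhds_unique_of_frequently_eq hF hG ((nhdsGT_basis a).frequently_iff.2 ?_)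
  intro ε hε
  obtain ⟨x, hx, hxFG⟩ := (Measure.dense_of_ae (ae_imp_of_ae_restrict h)).inter_open_nonempty
    (Ioo a ε) isOpen_Ioo (nonempty_Ioo.2 hε)
  exact ⟨x, hx, hxFG hx.1⟩

theorem intervalIntegrable_of_memLp_Ioi {g : ℝ → ℂ} {a b : ℝ}
    (hg : MemLp g 2 (volume.restrict (Ioi a))) (hab : a ≤ b) : IntervalIntegrable g volume a b := by
  rw [intervalIntegrable_iff_integrableOn_Ioc_of_le hab]
  have hg' : MemLp g 2 (volume.restrict (Ioc a b)) :=
    hg.mono_measure (Measure.restrict_mono Ioc_subset_Ioi_self le_rfl)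
  exact hg'.integrable (by norm_num)

theorem continuousOn_Ici_primitive {g : ℝ → ℂ} {a : ℝ}
    (hg : ∀ b, a ≤ b → IntervalIntegrable g volume a b) :
    ContinuousOn (fun x => ∫ t in a..x, g t) (Ici a) := by
  intro x hx
  have hx' : x < x + 1 := lt_add_one x
  have hax : a ≤ x + 1 := le_trans hx hx'.le
  have hcont := intervalIntegral.continuousOn_primitive_interval' (hg _ hax) left_mem_uIcc
  rw [uIcc_of_le hax] at hcont
  exact (hcont x ⟨hx, hx'.le⟩).mono_of_mem_nhdsWithin
    (inter_mem_nhdsWithin (Ici a) (Iic_mem_nhds hx'))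

theorem HasWeakDeriv.ae_eq_primitive {f g : L2Edge} {a : ℂ} (h : HasWeakDeriv (Ioi 0) f g)
    (hb : HasBoundaryValue f a) :
    f =ᵐ[volume.restrict (Ioi 0)] fun x => a + ∫ t in (0 : ℝ)..x, g t := by
  obtain ⟨F, hF, hfF, rfl⟩ := hb
  have hg : ∀ b, 0 ≤ b → IntervalIntegrable g volume 0 b := fun b hb =>
    intervalIntegrable_of_memLp_Ioi (Lp.memLp g) hb
  have hprim : ContinuousOn (fun x => 0 + ∫ t in (0 : ℝ)..x, g t) (Ici 0) :=
    continuousOn_const.add (continuousOn_Ici_primitive hg)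
  have hloc : LocallyIntegrable (fun x => 0 + ∫ t in (0 : ℝ)..x, g t)
      (volume.restrict (Ioi 0)) :=
    ((locallyIntegrableOn_iff_locallyIntegrable_restrict isClosed_Ici).1
      (hprim.locallyIntegrableOn measurableSet_Ici)).mono_measure
      (Measure.restrict_mono Ioi_subset_Ici_self le_rfl)
  obtain ⟨c, hc⟩ := h.exists_ae_eq_add_const isOpen_Ioi ordConnected_Ioi
    ((Lp.memLp f).locallyIntegrable (by norm_num)) hloc (hasWeakDeriv_Ioi_primitive hg 0)
  have hlim : ∀ {G : ℝ → ℂ}, ContinuousOn G (Ici 0) → Tendsto G (𝓝[>] 0) (𝓝 (G 0)) :=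
    fun hG => (hG 0 self_mem_Ici).mono Ioi_subset_Ici_self
  have hF0 : F 0 = c + (0 + ∫ t in (0 : ℝ)..0, g t) :=
    eq_of_ae_eq_of_tendsto_nhdsGT (hfF.symm.trans hc) (hlim hF)
      (hlim (continuousOn_const.add hprim))
  rw [intervalIntegral.integral_same, add_zero, add_zero] at hF0
  simpa only [hF0, zero_add] using hc

theorem HasWeakDeriv.integral_deriv_smul_of_hasBoundaryValue {f g : L2Edge} {a : ℂ}
    (h : HasWeakDeriv (Ioi 0) f g) (hb : HasBoundaryValue f a) {φ : ℝ → ℝ} (hφ : ContDiff ℝ 1 φ)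
    (hφc : HasCompactSupport φ) :
    ∫ x in Ioi (0 : ℝ), deriv φ x • f x = -(φ 0 • a) - ∫ x in Ioi (0 : ℝ), φ x • g x := by
  rw [← integral_Ioi_deriv_smul_primitive hφ hφc
    (fun b hb => intervalIntegrable_of_memLp_Ioi (Lp.memLp g) hb) a]
  exact integral_congr_ae ((h.ae_eq_primitive hb).mono fun x hx => by simp only [hx])

end BoundaryValue

/-! ### Gluing two half-lines along the reflection -/

section LineMaps

theorem coeFn_extendZero (f : L2Edge) : extendZero f =ᵐ[volume] (Ioi (0 : ℝ)).indicator f :=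
  MemLp.coeFn_toLp _

/-- The extension by zero, as a linear isometry. -/
def extendZeroₗᵢ : L2Edge →ₗᵢ[ℂ] L2Line where
  toFun := extendZero
  map_add' f g := by
    refine Lp.ext ?_
    filter_upwards [coeFn_extendZero (f + g), coeFn_extendZero f, coeFn_extendZero g,
      Lp.coeFn_add (extendZero f) (extendZero g), ae_imp_of_ae_restrict (Lp.coeFn_add f g)]
      with x hfg hf hg hsum hadd
    by_cases hx : x ∈ Ioi (0 : ℝ) <;> simp_all
  map_smul' c f := by
    refine Lp.ext ?_
    filter_upwards [coeFn_extendZero (c • f), coeFn_extendZero f,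
      Lp.coeFn_smul c (extendZero f), ae_imp_of_ae_restrict (Lp.coeFn_smul c f)]
      with x hcf hf hsmul hc
    by_cases hx : x ∈ Ioi (0 : ℝ) <;> simp_all
  norm_map' f := by
    change ‖extendZero f‖ = ‖f‖
    rw [extendZero, Lp.norm_toLp, Lp.norm_def,
      eLpNorm_indicator_eq_eLpNorm_restrict measurableSet_Ioi]

theorem coeFn_extendZeroₗᵢ (f : L2Edge) :
    extendZeroₗᵢ f =ᵐ[volume] (Ioi (0 : ℝ)).indicator f :=
  coeFn_extendZero f

/-- The restriction to the half-line, as a continuous linear map. -/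
def restrictEdgeL : L2Line →L[ℂ] L2Edge :=
  LpToLpRestrictCLM ℝ ℂ ℂ volume 2 (Ioi 0)

theorem coeFn_restrictEdgeL (f : L2Line) :
    restrictEdgeL f =ᵐ[volume.restrict (Ioi (0 : ℝ))] f :=
  LpToLpRestrictCLM_coeFn ℂ _ f

theorem HasWeakDeriv.restrictEdgeL {f g : L2Line} (h : HasWeakDeriv univ f g) :
    HasWeakDeriv (Ioi 0) (restrictEdgeL f) (restrictEdgeL g) :=
  (h.mono (subset_univ _)).congr (coeFn_restrictEdgeL f) (coeFn_restrictEdgeL g)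

/-- The reflection `f ↦ f (-·)` on `L²(ℝ)`. -/
def reflect : L2Line →ₗᵢ[ℂ] L2Line :=
  Lp.compMeasurePreservingₗᵢ ℂ Neg.neg (Measure.measurePreserving_neg volume)

theorem coeFn_reflect (f : L2Line) : reflect f =ᵐ[volume] fun x => f (-x) :=
  Lp.coeFn_compMeasurePreserving f (Measure.measurePreserving_neg volume)

theorem ae_comp_neg {p : ℝ → Prop} (h : ∀ᵐ x, p x) : ∀ᵐ x, p (-x) :=
  (Measure.measurePreserving_neg (volume : Measure ℝ)).quasiMeasurePreserving.ae h

theorem reflect_reflect (f : L2Line) : reflect (reflect f) = f := by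
  refine Lp.ext ?_
  filter_upwards [coeFn_reflect (reflect f), ae_comp_neg (coeFn_reflect f)] with x h₁ h₂
  rw [h₁, h₂, neg_neg]

theorem coeFn_reflect_extendZeroₗᵢ (f : L2Edge) :
    reflect (extendZeroₗᵢ f) =ᵐ[volume] fun x => (Ioi (0 : ℝ)).indicator f (-x) := by
  filter_upwards [coeFn_reflect (extendZeroₗᵢ f), ae_comp_neg (coeFn_extendZeroₗᵢ f)] with x h₁ h₂
  rw [h₁, h₂]

theorem neg_notMem_Ioi_zero {x : ℝ} (hx : x ∈ Ioi (0 : ℝ)) : -x ∉ Ioi (0 : ℝ) := by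
  simpa using (mem_Ioi.1 hx).le

theorem restrictEdgeL_extendZeroₗᵢ (f : L2Edge) : restrictEdgeL (extendZeroₗᵢ f) = f := by
  refine Lp.ext ?_
  filter_upwards [coeFn_restrictEdgeL (extendZeroₗᵢ f), ae_restrict_of_ae (coeFn_extendZeroₗᵢ f),
    ae_restrict_mem measurableSet_Ioi] with x hr he hx
  rw [hr, he, indicator_of_mem hx]

theorem restrictEdgeL_reflect_extendZeroₗᵢ (f : L2Edge) :
    restrictEdgeL (reflect (extendZeroₗᵢ f)) = 0 := by
  refine Lp.ext ?_
  filter_upwards [coeFn_restrictEdgeL (reflect (extendZeroₗᵢ f)),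
    ae_restrict_of_ae (coeFn_reflect_extendZeroₗᵢ f), ae_restrict_mem measurableSet_Ioi,
    Lp.coeFn_zero ℂ 2 (volume.restrict (Ioi (0 : ℝ)))] with x hr he hx h0
  rw [hr, he, h0, indicator_of_notMem (neg_notMem_Ioi_zero hx), Pi.zero_apply]

theorem extendZeroₗᵢ_restrictEdgeL_add_reflect (g : L2Line) :
    extendZeroₗᵢ (restrictEdgeL g) + reflect (extendZeroₗᵢ (restrictEdgeL (reflect g))) = g := by
  refine Lp.ext ?_
  have hpos := ae_imp_of_ae_restrict (coeFn_restrictEdgeL g)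
  have hneg := ae_comp_neg (ae_imp_of_ae_restrict (coeFn_restrictEdgeL (reflect g)))
  filter_upwards [Lp.coeFn_add (extendZeroₗᵢ (restrictEdgeL g))
      (reflect (extendZeroₗᵢ (restrictEdgeL (reflect g)))), coeFn_extendZeroₗᵢ (restrictEdgeL g),
    coeFn_reflect_extendZeroₗᵢ (restrictEdgeL (reflect g)), hpos, hneg,
    ae_comp_neg (coeFn_reflect g), Measure.ae_ne volume 0] with x hsum he hre hpos hneg hr hx0
  rw [hsum, Pi.add_apply, he, hre]
  rcases lt_or_gt_of_ne hx0 with hx | hx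
  · have hx' : -x ∈ Ioi (0 : ℝ) := neg_pos.2 hx
    rw [indicator_of_notMem (notMem_Ioi.2 hx.le), indicator_of_mem hx', hneg hx', hr, neg_neg,
      zero_add]
  · rw [indicator_of_mem (mem_Ioi.2 hx), indicator_of_notMem (neg_notMem_Ioi_zero hx), hpos hx,
      add_zero]

theorem norm_sq_extendZeroₗᵢ_add_reflect (f h : L2Edge) :
    ‖extendZeroₗᵢ f + reflect (extendZeroₗᵢ h)‖ ^ 2 = ‖f‖ ^ 2 + ‖h‖ ^ 2 := by
  have horth : inner ℂ (extendZeroₗᵢ f) (reflect (extendZeroₗᵢ h)) = 0 := by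
    rw [L2.inner_def]
    refine integral_eq_zero_of_ae ?_
    filter_upwards [coeFn_extendZeroₗᵢ f, coeFn_reflect_extendZeroₗᵢ h] with x hf hh
    rw [hf, hh]
    by_cases hx : x ∈ Ioi (0 : ℝ)
    · rw [indicator_of_notMem (neg_notMem_Ioi_zero hx), inner_zero_right, Pi.zero_apply]
    · rw [indicator_of_notMem hx, inner_zero_left, Pi.zero_apply]
  simpa only [LinearIsometry.norm_map, ← pow_two] using
    norm_add_sq_eq_norm_sq_add_norm_sq_of_inner_eq_zero _ _ horth

end LineMaps

section Reflection

/-- The pairs `(f, f')` with `f ∈ W^{1,2}(ℝ)`. -/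
def derivLineGraph : Submodule ℂ (L2Line × L2Line) where
  carrier := {p | HasWeakDeriv univ p.1 p.2}
  add_mem' := by
    rintro ⟨f, g⟩ ⟨f₁, g₁⟩ h h₁
    have hm : ∀ u : L2Line, MemLp u 2 (volume.restrict univ) := fun u => (Lp.memLp u).restrict _
    exact (h.add (hm _) (hm _) (hm _) (hm _) h₁).congr (ae_restrict_of_ae (Lp.coeFn_add _ _))
      (ae_restrict_of_ae (Lp.coeFn_add _ _))
  zero_mem' := (HasWeakDeriv.zero _).congr (ae_restrict_of_ae (Lp.coeFn_zero _ _ _))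
      (ae_restrict_of_ae (Lp.coeFn_zero _ _ _))
  smul_mem' := by
    rintro c ⟨f, g⟩ h
    exact (h.const_smul c).congr (ae_restrict_of_ae (Lp.coeFn_smul _ _))
      (ae_restrict_of_ae (Lp.coeFn_smul _ _))

theorem HasWeakDeriv.eq_of_line {f g g₁ : L2Line} (h : HasWeakDeriv univ f g)
    (h₁ : HasWeakDeriv univ f g₁) : g = g₁ := by
  have hsub : (f - f, g - g₁) ∈ derivLineGraph :=
    derivLineGraph.sub_mem (x := (f, g)) (y := (f, g₁)) h h₁
  rw [sub_self] at hsub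
  have hzero := HasWeakDeriv.eq_zero isOpen_univ ((Lp.memLp _).restrict _) hsub
    (ae_restrict_of_ae (Lp.coeFn_zero _ _ _))
  rw [Measure.restrict_univ] at hzero
  exact sub_eq_zero.1 (Lp.ext (hzero.trans (Lp.coeFn_zero _ _ _).symm))

theorem HasWeakDeriv.comp_neg {f g : ℝ → ℂ} (h : HasWeakDeriv univ f g) :
    HasWeakDeriv univ (fun x => f (-x)) fun x => -g (-x) := by
  intro φ hφ hφc _
  have hweak := h (fun x => φ (-x)) (hφ.comp contDiff_neg)
    (hφc.comp_homeomorph (Homeomorph.neg ℝ)) (subset_univ _)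
  simp only [Measure.restrict_univ, deriv_comp_neg, neg_smul, smul_neg, integral_neg] at hweak ⊢
  rw [← integral_neg_eq_self (fun x => deriv φ x • f (-x)),
    ← integral_neg_eq_self (fun x => φ x • g (-x))]
  simpa only [neg_neg] using congrArg Neg.neg hweak

theorem HasWeakDeriv.reflect {f g : L2Line} (h : HasWeakDeriv univ f g) :
    HasWeakDeriv univ (reflect f) (-reflect g : L2Line) := by
  rw [← map_neg]
  refine h.comp_neg.congr (ae_restrict_of_ae (coeFn_reflect f)) (ae_restrict_of_ae ?_)
  filter_upwards [coeFn_reflect (-g), ae_comp_neg (Lp.coeFn_neg g)] with x h₁ h₂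
  rw [h₁, h₂, Pi.neg_apply]

theorem reflect_mem_laplacianLineGraph {f g : L2Line} (h : (f, g) ∈ laplacianLineGraph) :
    (reflect f, reflect g) ∈ laplacianLineGraph := by
  obtain ⟨f', hf, hf'⟩ := h
  have hneg := derivLineGraph.neg_mem (x := (reflect f', -reflect g)) hf'.reflect
  rw [Prod.neg_mk, neg_neg] at hneg
  exact ⟨-reflect f', hf.reflect, hneg⟩

theorem reflect_mem_laplacianLineGraph_iff {f g : L2Line} :
    (reflect f, reflect g) ∈ laplacianLineGraph ↔ (f, g) ∈ laplacianLineGraph :=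
  ⟨fun h => by simpa only [reflect_reflect] using reflect_mem_laplacianLineGraph h,
    reflect_mem_laplacianLineGraph⟩

theorem freeGroup_reflect (t : ℝ) (f : L2Line) :
    freeGroup t (reflect f) = reflect (freeGroup t f) := by
  have hU := isGroupGeneratedBy_freeGroup
  let R : L2Line →L[ℂ] L2Line := reflect.toContinuousLinearMap
  have hRR : ∀ f, R (R f) = f := reflect_reflect
  have hV : IsGroupGeneratedBy (fun t => R ∘L freeGroup t ∘L R) (Complex.I • laplacianLine) :=
    (hU.isIsometryGroup.pullback one_ne_zero (fun f => by rw [one_mul]; exact reflect.norm_map f)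
      hRR fun _ _ => hRR _).isGroupGeneratedBy fun f g => by
        refine Iff.trans ?_ <| (hU.generator (R f) (R g)).trans
          (hasDerivAt_pullback_iff (J := R) (P := R) hRR fun _ => hRR _).symm
        rw [mem_smul_graph_iff Complex.I_ne_zero, mem_smul_graph_iff Complex.I_ne_zero,
          laplacianLine_graph, ← map_smul]
        exact reflect_mem_laplacianLineGraph_iff.symm
  have hconj : freeGroup t = R ∘L freeGroup t ∘L R := congrFun (hU.unique hV) t
  calc freeGroup t (reflect f) = R (freeGroup t (R (R f))) := DFunLike.congr_fun hconj (R f)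
    _ = reflect (freeGroup t f) := by rw [hRR]; rfl

end Reflection

section Gluing

theorem integral_smul_extendZeroₗᵢ_add_reflect {φ : ℝ → ℝ} (hφ : Continuous φ)
    (hφc : HasCompactSupport φ) (f₁ f₂ : L2Edge) :
    ∫ x, φ x • (extendZeroₗᵢ f₁ + reflect (extendZeroₗᵢ f₂)) x =
      (∫ x in Ioi (0 : ℝ), φ x • f₁ x) + ∫ x in Ioi (0 : ℝ), φ (-x) • f₂ x := by
  have hint : ∀ u : L2Line, Integrable (fun x => φ x • u x) volume := fun u => by
    simpa only [Measure.restrict_univ] using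
      integrable_test_smul ((Lp.memLp u).restrict univ) hφ hφc
  have hedge : ∀ (ψ : ℝ → ℝ) (f : L2Edge),
      ∫ x, ψ x • (Ioi (0 : ℝ)).indicator f x = ∫ x in Ioi (0 : ℝ), ψ x • f x := fun ψ f => by
    simp only [← indicator_smul_apply, integral_indicator measurableSet_Ioi]
  calc ∫ x, φ x • (extendZeroₗᵢ f₁ + reflect (extendZeroₗᵢ f₂)) x
      = (∫ x, φ x • extendZeroₗᵢ f₁ x) + ∫ x, φ x • reflect (extendZeroₗᵢ f₂) x := by
        rw [← integral_add (hint _) (hint _)]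
        refine integral_congr_ae ?_
        filter_upwards [Lp.coeFn_add (extendZeroₗᵢ f₁) (reflect (extendZeroₗᵢ f₂))] with x hx
        rw [hx, Pi.add_apply, smul_add]
    _ = (∫ x, φ x • (Ioi (0 : ℝ)).indicator f₁ x) +
        ∫ x, φ x • (Ioi (0 : ℝ)).indicator f₂ (-x) := by
        congr 1 <;> refine integral_congr_ae ?_
        · exact (coeFn_extendZeroₗᵢ f₁).mono fun x hx => by simp only [hx]
        · exact (coeFn_reflect_extendZeroₗᵢ f₂).mono fun x hx => by simp only [hx]
    _ = _ := by
        rw [← integral_neg_eq_self (fun x => φ x • (Ioi (0 : ℝ)).indicator f₂ (-x))]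
        simp only [neg_neg]
        rw [hedge, hedge fun x => φ (-x)]

theorem hasWeakDeriv_extendZeroₗᵢ_add_reflect {f₁ g₁ f₂ g₂ : L2Edge} {a : ℂ}
    (h₁ : HasWeakDeriv (Ioi 0) f₁ g₁) (hb₁ : HasBoundaryValue f₁ a)
    (h₂ : HasWeakDeriv (Ioi 0) f₂ g₂) (hb₂ : HasBoundaryValue f₂ a) :
    HasWeakDeriv univ (extendZeroₗᵢ f₁ + reflect (extendZeroₗᵢ f₂) : L2Line)
      (extendZeroₗᵢ g₁ + reflect (extendZeroₗᵢ (-g₂)) : L2Line) := by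
  intro φ hφ hφc _
  have hφ1 : ContDiff ℝ 1 φ := hφ.of_le (by simp)
  have hpos := h₁.integral_deriv_smul_of_hasBoundaryValue hb₁ hφ1 hφc
  have hneg := h₂.integral_deriv_smul_of_hasBoundaryValue hb₂ (hφ1.comp contDiff_neg)
    (hφc.comp_homeomorph (Homeomorph.neg ℝ))
  have hg₂ : ∫ x in Ioi (0 : ℝ), φ (-x) • (-g₂ : L2Edge) x =
      -∫ x in Ioi (0 : ℝ), φ (-x) • g₂ x := by
    rw [← integral_neg]
    exact integral_congr_ae ((Lp.coeFn_neg g₂).mono fun x hx => by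
      simp only [hx, Pi.neg_apply, smul_neg])
  have hcomp : ∀ x, deriv (φ ∘ fun x => -x) x = -deriv φ (-x) := deriv_comp_neg φ
  simp only [hcomp, Function.comp_apply, neg_zero, neg_smul, integral_neg] at hneg
  rw [Measure.restrict_univ,
    integral_smul_extendZeroₗᵢ_add_reflect (hφ1.continuous_deriv le_rfl) hφc.deriv,
    integral_smul_extendZeroₗᵢ_add_reflect hφ.continuous hφc, hg₂]
  linear_combination hpos - hneg

/-- The triples `(f, f', f(0))` with `f ∈ W^{1,2}(0, ∞)`. -/
def traceGraph : Submodule ℂ (L2Edge × L2Edge × ℂ) where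
  carrier := {p | HasWeakDeriv (Ioi 0) p.1 p.2.1 ∧ HasBoundaryValue p.1 p.2.2}
  add_mem' := by
    rintro ⟨f, g, a⟩ ⟨f₁, g₁, a₁⟩ ⟨h, hb⟩ ⟨h₁, hb₁⟩
    exact ⟨(h.add (Lp.memLp _) (Lp.memLp _) (Lp.memLp _) (Lp.memLp _) h₁).congr
      (Lp.coeFn_add _ _) (Lp.coeFn_add _ _), hb.add hb₁⟩
  zero_mem' := ⟨(HasWeakDeriv.zero _).congr (Lp.coeFn_zero _ _ _) (Lp.coeFn_zero _ _ _),
    HasBoundaryValue.zero⟩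
  smul_mem' := by
    rintro c ⟨f, g, a⟩ ⟨h, hb⟩
    exact ⟨(h.const_smul c).congr (Lp.coeFn_smul _ _) (Lp.coeFn_smul _ _), hb.const_smul c⟩

end Gluing

/-! ### The reflection principle on the star graph -/

section Unfolding

variable {n : ℕ} {S : Matrix (Fin n) (Fin n) ℂ}

/-- The direct sum of `n` copies of `L²(ℝ)`, one line for each edge. -/
abbrev L2Lines (n : ℕ) : Type := PiLp 2 (fun _ : Fin n => L2Line)

/-- The edgewise extension by zero. -/
def extendStar : L2Star n →L[ℂ] L2Lines n :=
  diagonal extendZeroₗᵢ.toContinuousLinearMap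

/-- The reflection `f ↦ f (-·)` on every line. -/
def reflectLines : L2Lines n →L[ℂ] L2Lines n :=
  diagonal reflect.toContinuousLinearMap

/-- The restriction of the lines to the edges. -/
def restrictStar : L2Lines n →L[ℂ] L2Star n :=
  diagonal restrictEdgeL

/-- The extension of a function on the star graph to `n` functions on the line, by the
reflection rule `f (-x) = S f (x)`. -/
def unfold (S : Matrix (Fin n) (Fin n) ℂ) : L2Star n →L[ℂ] L2Lines n :=
  extendStar + reflectLines ∘L extendStar ∘L matrixAction S

/-- The symmetry `f (-x) = S f (x)` of the functions that arise by unfolding. -/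
def IsReflectionInvariant (S : Matrix (Fin n) (Fin n) ℂ) (g : L2Lines n) : Prop :=
  reflectLines g = matrixAction S g

theorem reflectLines_reflectLines (g : L2Lines n) : reflectLines (reflectLines g) = g := by
  ext1 j
  exact reflect_reflect (g j)

theorem unfold_apply (S : Matrix (Fin n) (Fin n) ℂ) (f : L2Star n) :
    unfold S f = extendStar f + reflectLines (extendStar (matrixAction S f)) := rfl

theorem unfold_neg (S : Matrix (Fin n) (Fin n) ℂ) (f : L2Star n) :
    unfold (-S) f = -unfold S f + (2 : ℂ) • extendStar f := by
  simp only [unfold_apply, matrixAction_neg, map_neg]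
  module

theorem restrictStar_unfold (S : Matrix (Fin n) (Fin n) ℂ) (f : L2Star n) :
    restrictStar (unfold S f) = f := by
  ext1 j
  change restrictEdgeL (extendZeroₗᵢ (f j) + reflect (extendZeroₗᵢ (matrixAction S f j))) = f j
  rw [map_add, restrictEdgeL_extendZeroₗᵢ, restrictEdgeL_reflect_extendZeroₗᵢ, add_zero]

theorem isReflectionInvariant_unfold (hS : S * S = 1) (f : L2Star n) :
    IsReflectionInvariant S (unfold S f) := by
  have hcomm : ∀ f : L2Star n, matrixAction S (extendStar f) = extendStar (matrixAction S f) :=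
    fun f => (diagonal_matrixAction _ S f).symm
  have hcomm' : ∀ g : L2Lines n, matrixAction S (reflectLines g) =
      reflectLines (matrixAction S g) := fun g => (diagonal_matrixAction _ S g).symm
  rw [IsReflectionInvariant, unfold_apply, map_add, map_add, reflectLines_reflectLines, hcomm',
    hcomm, hcomm, matrixAction_matrixAction, hS, matrixAction_one, add_comm]

theorem IsReflectionInvariant.unfold_restrictStar {g : L2Lines n}
    (hg : IsReflectionInvariant S g) : unfold S (restrictStar g) = g := by
  have hcomm : matrixAction S (restrictStar g) = restrictStar (reflectLines g) := by
    rw [hg]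
    exact (diagonal_matrixAction restrictEdgeL S g).symm
  rw [unfold_apply, hcomm]
  ext1 j
  exact extendZeroₗᵢ_restrictEdgeL_add_reflect (g j)

theorem norm_unfold (hS : Sᴴ * S = 1) (f : L2Star n) : ‖unfold S f‖ = √2 * ‖f‖ := by
  rw [← sq_eq_sq₀ (norm_nonneg _) (by positivity), mul_pow, Real.sq_sqrt zero_le_two]
  calc ‖unfold S f‖ ^ 2 = ∑ j, (‖f j‖ ^ 2 + ‖matrixAction S f j‖ ^ 2) := by
        rw [PiLp.norm_sq_eq_of_L2]
        exact Finset.sum_congr rfl fun j _ =>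
          norm_sq_extendZeroₗᵢ_add_reflect (f j) (matrixAction S f j)
    _ = ‖f‖ ^ 2 + ‖matrixAction S f‖ ^ 2 := by
        rw [Finset.sum_add_distrib, ← PiLp.norm_sq_eq_of_L2, ← PiLp.norm_sq_eq_of_L2]
    _ = 2 * ‖f‖ ^ 2 := by rw [norm_matrixAction hS, two_mul]

theorem IsReflectionInvariant.diagonal_freeGroup {g : L2Lines n}
    (hg : IsReflectionInvariant S g) (t : ℝ) :
    IsReflectionInvariant S (diagonal (freeGroup t) g) := by
  rw [IsReflectionInvariant, ← diagonal_matrixAction, ← hg]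
  ext1 j
  exact (freeGroup_reflect t (g j)).symm

theorem hasWeakDeriv_matrixAction {f g : L2Lines n} (h : ∀ j, HasWeakDeriv univ (f j) (g j))
    (S : Matrix (Fin n) (Fin n) ℂ) (j : Fin n) :
    HasWeakDeriv univ (matrixAction S f j) (matrixAction S g j) := by
  have hsum : ∑ k, S j k • (f k, g k) ∈ derivLineGraph :=
    derivLineGraph.sum_mem fun k _ => derivLineGraph.smul_mem _ (h k)
  have hpair : ∑ k, S j k • (f k, g k) = (matrixAction S f j, matrixAction S g j) := by
    simp only [Prod.ext_iff, Prod.fst_sum, Prod.snd_sum, Prod.smul_mk, matrixAction_apply,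
      and_self]
  rw [hpair] at hsum
  exact hsum

theorem IsReflectionInvariant.of_hasWeakDeriv {f g : L2Lines n} (hf : IsReflectionInvariant S f)
    (h : ∀ j, HasWeakDeriv univ (f j) (g j)) : IsReflectionInvariant (-S) g := by
  ext1 j
  have hfj : reflect (f j) = matrixAction S f j := congrArg (fun u : L2Lines n => u j) hf
  have hreflect := (h j).reflect
  rw [hfj] at hreflect
  rw [matrixAction_neg]
  exact neg_eq_iff_eq_neg.1 (hreflect.eq_of_line (hasWeakDeriv_matrixAction h S j))

theorem coeFn_matrixAction {g : L2Lines n} {G : Fin n → ℝ → ℂ} (hgG : ∀ j, g j =ᵐ[volume] G j)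
    (S : Matrix (Fin n) (Fin n) ℂ) (j : Fin n) :
    matrixAction S g j =ᵐ[volume] fun x => ∑ k, S j k * G k x := by
  have hterm : ∀ᵐ x : ℝ, ∀ k, (S j k • g k : L2Line) x = S j k * G k x := by
    refine ae_all_iff.2 fun k => ?_
    filter_upwards [Lp.coeFn_smul (S j k) (g k), hgG k] with x hsmul hG
    rw [hsmul, Pi.smul_apply, hG, smul_eq_mul]
  rw [matrixAction_apply]
  filter_upwards [Lp.coeFn_finsetSum Finset.univ fun k => S j k • g k, hterm] with x hsum hx
  rw [hsum, Finset.sum_apply]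
  exact Finset.sum_congr rfl fun k _ => hx k

theorem IsReflectionInvariant.mulVec_eq {g : L2Lines n} (hg : IsReflectionInvariant S g)
    {G : Fin n → ℝ → ℂ} (hG : ∀ j, Continuous (G j)) (hgG : ∀ j, g j =ᵐ[volume] G j) :
    (S *ᵥ fun j => G j 0) = fun j => G j 0 := by
  funext j
  have hsum := coeFn_matrixAction hgG S j
  rw [← hg] at hsum
  have hae : (fun x => G j (-x)) =ᵐ[volume] fun x => ∑ k, S j k * G k x := by
    filter_upwards [hsum, coeFn_reflect (g j), ae_comp_neg (hgG j)] with x hx hreflect hGx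
    rw [← hGx, ← hreflect, ← hx]
    rfl
  have heq := (Continuous.ae_eq_iff_eq (volume : Measure ℝ) ((hG j).comp continuous_neg)
    (continuous_finsetSum _ fun k _ => continuous_const.mul (hG k))).1 hae
  have hzero : G j (-0) = ∑ k, S j k * G k 0 := congrFun heq 0
  rw [neg_zero] at hzero
  exact hzero.symm

theorem hasBoundaryValue_restrictEdgeL {f : L2Line} {F : ℝ → ℂ} (hF : Continuous F)
    (hfF : f =ᵐ[volume] F) : HasBoundaryValue (restrictEdgeL f) (F 0) :=
  ⟨F, hF.continuousOn, (coeFn_restrictEdgeL f).trans (ae_restrict_of_ae hfF), rfl⟩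

theorem hasWeakDeriv_unfold {f g : L2Star n} {a : Fin n → ℂ} (h : IsDeriv f g)
    (ha : IsVertexValue f a) (hS : S *ᵥ a = a) (j : Fin n) :
    HasWeakDeriv univ (unfold S f j) (unfold (-S) g j) := by
  have hsum : ∑ k, S j k • (f k, g k, a k) ∈ traceGraph :=
    traceGraph.sum_mem fun k _ => traceGraph.smul_mem _ ⟨h k, ha k⟩
  have htriple : ∑ k, S j k • (f k, g k, a k) =
      (matrixAction S f j, matrixAction S g j, (S *ᵥ a) j) := by
    simp only [Prod.ext_iff, Prod.fst_sum, Prod.snd_sum, Prod.smul_mk, matrixAction_apply,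
      Matrix.mulVec, dotProduct, smul_eq_mul, and_self]
  rw [htriple, hS] at hsum
  rw [unfold_apply, unfold_apply, matrixAction_neg]
  exact hasWeakDeriv_extendZeroₗᵢ_add_reflect (h j) (ha j) hsum.1 hsum.2

end Unfolding

section ReflectedGroup

variable {n : ℕ} {A B S : Matrix (Fin n) (Fin n) ℂ}

/-- `S` is the reflection of `ℂⁿ` for which the vertex condition `A F + B F' = 0` says that `F` is
fixed by `S` and `F'` is fixed by `-S`. -/
structure IsVertexReflection (A B S : Matrix (Fin n) (Fin n) ℂ) : Prop where
  isHermitian : S.IsHermitian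
  mul_self : S * S = 1
  coupling : ∀ F F' : Fin n → ℂ, A *ᵥ F + B *ᵥ F' = 0 ↔ S *ᵥ F = F ∧ -S *ᵥ F' = F'

theorem IsVertexReflection.conjTranspose_mul_self (hS : IsVertexReflection A B S) :
    Sᴴ * S = 1 := by
  rw [hS.isHermitian.eq, hS.mul_self]

theorem IsVertexReflection.unfold_mem_laplacianLineGraph (hS : IsVertexReflection A B S)
    {f g : L2Star n} (h : (f, g) ∈ hamiltonianGraph A B) (j : Fin n) :
    (unfold S f j, -unfold S g j) ∈ laplacianLineGraph := by
  obtain ⟨f', a, b, hf, hf', ha, hb, hab⟩ := h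
  obtain ⟨hSa, hSb⟩ := (hS.coupling a b).1 hab
  refine ⟨unfold (-S) f' j, hasWeakDeriv_unfold hf ha hSa j, ?_⟩
  have hunfold := hasWeakDeriv_unfold hf' hb hSb j
  rwa [neg_neg, map_neg] at hunfold

theorem IsVertexReflection.mem_hamiltonianGraph_of_unfold (hS : IsVertexReflection A B S)
    {f g : L2Star n} (h : ∀ j, (unfold S f j, -unfold S g j) ∈ laplacianLineGraph) :
    (f, g) ∈ hamiltonianGraph A B := by
  choose k hfk hkg using h
  replace hfk : ∀ j, HasWeakDeriv univ (unfold S f j) (k j) := hfk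
  replace hkg : ∀ j, HasWeakDeriv univ (k j) ((-unfold S g) j) := hkg
  have hf := isReflectionInvariant_unfold hS.mul_self f
  have hk : IsReflectionInvariant (-S) (WithLp.toLp 2 k) := hf.of_hasWeakDeriv hfk
  have hloc : ∀ u : L2Line, LocallyIntegrable u volume := fun u =>
    (Lp.memLp u).locallyIntegrable one_le_two
  choose F hF hfF using fun j => (hfk j).exists_continuous_ae_eq (hloc _) (hloc _)
  choose G hG hkG using fun j => (hkg j).exists_continuous_ae_eq (hloc _) (hloc _)
  have hfr := restrictStar_unfold S f
  have hgr : restrictStar (-unfold S g) = -g := by rw [map_neg, restrictStar_unfold]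
  rw [← hfr]
  refine ⟨restrictStar (WithLp.toLp 2 k), fun j => F j 0, fun j => G j 0,
    fun j => (hfk j).restrictEdgeL, ?_, fun j => hasBoundaryValue_restrictEdgeL (hF j) (hfF j),
    fun j => hasBoundaryValue_restrictEdgeL (hG j) (hkG j),
    (hS.coupling _ _).2 ⟨hf.mulVec_eq hF hfF, hk.mulVec_eq hG hkG⟩⟩
  rw [← hgr]
  exact fun j => (hkg j).restrictEdgeL

theorem IsVertexReflection.mem_hamiltonian_graph_iff (hS : IsVertexReflection A B S)
    {f g : L2Star n} :
    (f, g) ∈ (hamiltonian A B).graph ↔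
      ∀ j, (unfold S f j, -unfold S g j) ∈ laplacianLineGraph := by
  rw [hamiltonian_graph]
  exact ⟨hS.unfold_mem_laplacianLineGraph, hS.mem_hamiltonianGraph_of_unfold⟩

/-- The group `e^{-itH⋆}` given by the reflection principle. -/
def reflectedGroup (S : Matrix (Fin n) (Fin n) ℂ) (t : ℝ) : L2Star n →L[ℂ] L2Star n :=
  restrictStar ∘L diagonal (freeGroup t) ∘L unfold S

theorem IsVertexReflection.isGroupGeneratedBy_reflectedGroup (hS : IsVertexReflection A B S) :
    IsGroupGeneratedBy (reflectedGroup S) ((-Complex.I) • hamiltonian A B) := by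
  have hinv : ∀ (t : ℝ) (f : L2Star n), unfold S (restrictStar (diagonal (freeGroup t)
      (unfold S f))) = diagonal (freeGroup t) (unfold S f) := fun t f =>
    ((isReflectionInvariant_unfold hS.mul_self f).diagonal_freeGroup t).unfold_restrictStar
  have hfree := isGroupGeneratedBy_freeGroup
  have hgroup : IsIsometryGroup (reflectedGroup S) :=
    hfree.isIsometryGroup.diagonal.pullback (by positivity : √2 ≠ 0)
      (norm_unfold hS.conjTranspose_mul_self) (restrictStar_unfold S) hinv
  refine hgroup.isGroupGeneratedBy fun f g => Iff.trans ?_ <|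
    (hasDerivAt_pullback_iff (restrictStar_unfold S) fun t => hinv t f).symm
  rw [hasDerivAt_piLp, mem_smul_graph_iff (neg_ne_zero.2 Complex.I_ne_zero),
    hS.mem_hamiltonian_graph_iff]
  refine forall_congr' fun j => Iff.trans ?_ (hfree.generator (unfold S f j) (unfold S g j))
  rw [mem_smul_graph_iff Complex.I_ne_zero, laplacianLine_graph, map_smul,
    PiLp.smul_apply, inv_neg, neg_smul, neg_neg]

theorem IsVertexReflection.eigenfunctions_hamiltonian (hS : IsVertexReflection A B S) :
    eigenfunctions (hamiltonian A B) = ∅ := by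
  refine eq_empty_of_forall_notMem fun f ⟨hf, lam, hlam⟩ => hf ?_
  have hunfold : unfold S f = 0 := by
    ext1 j
    have hj := hS.mem_hamiltonian_graph_iff.1 hlam j
    rw [map_smul, PiLp.smul_apply, ← neg_smul] at hj
    exact eq_zero_of_mem_laplacianLineGraph hj
  rw [← restrictStar_unfold S f, hunfold, map_zero]

theorem isDeriv_reflectedGroup {v v' : L2Star n} {a : Fin n → ℂ} (h : IsDeriv v v')
    (ha : IsVertexValue v a) (hSa : S *ᵥ a = a) (t : ℝ) :
    IsDeriv (reflectedGroup S t v)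
      (-reflectedGroup S t v' + (2 : ℂ) • freeGroupOnEdges t v') := by
  have hline : ∀ j, HasWeakDeriv univ (diagonal (freeGroup t) (unfold S v) j)
      (diagonal (freeGroup t) (unfold (-S) v') j) := fun j =>
    (hasWeakDeriv_unfold h ha hSa j).freeGroup t
  have hderiv : restrictStar (diagonal (freeGroup t) (unfold (-S) v')) =
      -reflectedGroup S t v' + (2 : ℂ) • freeGroupOnEdges t v' := by
    rw [unfold_neg, map_add, map_neg, map_smul, map_add, map_neg, map_smul]
    rfl
  rw [← hderiv]
  exact fun j => (hline j).restrictEdgeL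

theorem projC_eq_one {E : Type*} [NormedAddCommGroup E] [InnerProductSpace ℂ E] [CompleteSpace E]
    {T : E →ₗ.[ℂ] E} (h : eigenfunctions T = ∅) : projC T = 1 := by
  have hspan : (Submodule.span ℂ (eigenfunctions T)).topologicalClosure = ⊥ := by
    rw [h, Submodule.span_empty]
    exact IsClosed.submodule_topologicalClosure_eq (by simp)
  ext1 f
  simp [projC, hspan]

end ReflectedGroup

/-! ### Coupling conditions without Robin part -/

section Coupling

variable {n : ℕ} {A B : Matrix (Fin n) (Fin n) ℂ}

theorem sub_mulVec_eq_self_iff {P Q : Matrix (Fin n) (Fin n) ℂ} (h : P + Q = 1)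
    (F : Fin n → ℂ) : (P - Q) *ᵥ F = F ↔ Q *ᵥ F = 0 := by
  have hF : (P - Q) *ᵥ F = F - (2 : ℂ) • Q *ᵥ F := by
    rw [eq_sub_of_add_eq h, Matrix.sub_mulVec, Matrix.sub_mulVec, Matrix.one_mulVec]
    module
  rw [hF, sub_eq_self, smul_eq_zero_iff_right two_ne_zero]

theorem numPosEigenvalues_eq_zero {M : Matrix (Fin n) (Fin n) ℂ} (hM : M.IsHermitian)
    (h : M = 0) : numPosEigenvalues hM = 0 := by
  simp [numPosEigenvalues, hM.eigenvalues_eq_zero_iff.2 h]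

namespace CouplingParts

/-- The reflection `P_N - P_D` of `ℂⁿ`: in the absence of a Robin part, an incoming wave is
reflected at the vertex with the sign `+` on its Neumann and `-` on its Dirichlet component. -/
def reflection (C : CouplingParts A B) : Matrix (Fin n) (Fin n) ℂ := C.PN - C.PD

theorem PN_add_PD (C : CouplingParts A B) (hR : C.PR = 0) : C.PN + C.PD = 1 := by
  have hsum := C.sum_eq
  rw [hR, sub_sub, eq_comm, sub_eq_zero] at hsum
  rw [hsum, add_comm]

theorem reflection_mulVec_eq_iff (C : CouplingParts A B) (hR : C.PR = 0) (F : Fin n → ℂ) :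
    C.reflection *ᵥ F = F ↔ C.PD *ᵥ F = 0 :=
  sub_mulVec_eq_self_iff (C.PN_add_PD hR) F

theorem neg_reflection_mulVec_eq_iff (C : CouplingParts A B) (hR : C.PR = 0) (F : Fin n → ℂ) :
    -C.reflection *ᵥ F = F ↔ C.PN *ᵥ F = 0 := by
  rw [reflection, neg_sub]
  exact sub_mulVec_eq_self_iff ((add_comm _ _).trans (C.PN_add_PD hR)) F

theorem coupling_iff (C : CouplingParts A B) (hR : C.PR = 0) (F F' : Fin n → ℂ) :
    A *ᵥ F + B *ᵥ F' = 0 ↔ C.PD *ᵥ F = 0 ∧ C.PN *ᵥ F' = 0 := by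
  simp [C.coupling, hR]

theorem isVertexReflection (C : CouplingParts A B) (hR : C.PR = 0) :
    IsVertexReflection A B C.reflection := by
  have hherm : star C.reflection = C.reflection :=
    (C.projN.isSelfAdjoint.sub C.projD.isSelfAdjoint).star_eq
  have hunitary : C.reflection ∈ unitary (Matrix (Fin n) (Fin n) ℂ) := by
    have heq : C.reflection = 2 * C.PN - 1 := by
      rw [reflection, ← C.PN_add_PD hR, two_mul, add_sub_add_left_eq_sub]
    exact heq ▸ C.projN.two_mul_sub_one_mem_unitary
  have hmul := Unitary.star_mul_self_of_mem hunitary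
  refine ⟨hherm, by rwa [hherm] at hmul, fun F F' => ?_⟩
  rw [C.reflection_mulVec_eq_iff hR, C.neg_reflection_mulVec_eq_iff hR, C.coupling_iff hR]

theorem mul_PN (C : CouplingParts A B) (hR : C.PR = 0) : A * C.PN = 0 := by
  refine Matrix.ext_of_mulVec_single fun i => ?_
  have hcoupling := (C.coupling_iff hR (C.PN *ᵥ Pi.single i 1) 0).2
    ⟨by rw [Matrix.mulVec_mulVec, C.orthDN, Matrix.zero_mulVec], Matrix.mulVec_zero _⟩
  rwa [Matrix.mulVec_zero, add_zero, Matrix.mulVec_mulVec,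
    ← Matrix.zero_mulVec (Pi.single i (1 : ℂ))] at hcoupling

theorem PN_mul_PD (C : CouplingParts A B) : C.PN * C.PD = 0 := by
  have hstar := congrArg star C.orthDN
  rwa [star_mul, C.projD.isSelfAdjoint.star_eq, C.projN.isSelfAdjoint.star_eq, star_zero] at hstar

theorem mul_PD (C : CouplingParts A B) (hR : C.PR = 0) : B * C.PD = 0 := by
  refine Matrix.ext_of_mulVec_single fun i => ?_
  have hcoupling := (C.coupling_iff hR 0 (C.PD *ᵥ Pi.single i 1)).2
    ⟨Matrix.mulVec_zero _, by rw [Matrix.mulVec_mulVec, C.PN_mul_PD, Matrix.zero_mulVec]⟩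
  rwa [Matrix.mulVec_zero, zero_add, Matrix.mulVec_mulVec,
    ← Matrix.zero_mulVec (Pi.single i (1 : ℂ))] at hcoupling

theorem mul_conjTranspose_eq_zero (C : CouplingParts A B) (hR : C.PR = 0) : A * Bᴴ = 0 := by
  have hB : C.PD * Bᴴ = 0 := by
    have hstar := congrArg star (C.mul_PD hR)
    rwa [star_mul, C.projD.isSelfAdjoint.star_eq, star_zero] at hstar
  calc A * Bᴴ = A * (C.PN + C.PD) * Bᴴ := by rw [C.PN_add_PD hR, mul_one]
    _ = A * C.PN * Bᴴ + A * (C.PD * Bᴴ) := by rw [mul_add, add_mul, mul_assoc A C.PD]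
    _ = 0 := by rw [C.mul_PN hR, hB, zero_mul, mul_zero, add_zero]

end CouplingParts

end Coupling

end StarGraph

end

theorem proposition2p15 {n : ℕ} (hn : 1 ≤ n) (A B : Matrix (Fin n) (Fin n) ℂ)
    (hrank : (Matrix.fromCols A B).rank = n) (hAB : (A * Bᴴ).IsHermitian)
    (C : StarGraph.CouplingParts A B) (hR : C.PR = 0) :
    StarGraph.IsGroupGeneratedBy (StarGraph.starGroup A B)
        ((-Complex.I) • StarGraph.hamiltonian A B) ∧
      StarGraph.IsGroupGeneratedBy StarGraph.freeGroup (Complex.I • StarGraph.laplacianLine) ∧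
      (∃ (lam : Fin (StarGraph.numPosEigenvalues hAB) → ℝ)
          (φ φ' : Fin (StarGraph.numPosEigenvalues hAB) → StarGraph.L2Star n),
        StarGraph.IsEigencouples (StarGraph.hamiltonian A B) lam φ ∧
          ∀ l, StarGraph.IsDeriv (φ l) (φ' l)) ∧
      ∀ (lam : Fin (StarGraph.numPosEigenvalues hAB) → ℝ)
        (φ φ' : Fin (StarGraph.numPosEigenvalues hAB) → StarGraph.L2Star n),
        StarGraph.IsEigencouples (StarGraph.hamiltonian A B) lam φ →
        (∀ l, StarGraph.IsDeriv (φ l) (φ' l)) →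
        ∀ v ∈ StarGraph.formDomain C.PD, ∀ v' : StarGraph.L2Star n, StarGraph.IsDeriv v v' →
          ∀ t : ℝ, StarGraph.IsDeriv (StarGraph.starGroup A B t v)
            (-(StarGraph.starGroup A B t (StarGraph.projC (StarGraph.hamiltonian A B) v'))
              + (2 : ℂ) • StarGraph.freeGroupOnEdges t v'
              + ∑ l, (inner ℂ (φ l) v * Complex.exp (-Complex.I * t * lam l)) • φ' l) := by
  have hS := C.isVertexReflection hR
  have hU := hS.isGroupGeneratedBy_reflectedGroup
  have hstar : StarGraph.starGroup A B = StarGraph.reflectedGroup C.reflection := hU.expGroup_eq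
  have hno_eigen := hS.eigenfunctions_hamiltonian
  have : IsEmpty (Fin (StarGraph.numPosEigenvalues hAB)) := by
    rw [StarGraph.numPosEigenvalues_eq_zero hAB (C.mul_conjTranspose_eq_zero hR)]
    infer_instance
  have heigen : StarGraph.IsEigencouples (ι := Fin (StarGraph.numPosEigenvalues hAB))
      (StarGraph.hamiltonian A B) isEmptyElim isEmptyElim :=
    ⟨⟨isEmptyElim, isEmptyElim⟩, isEmptyElim, hno_eigen ▸ empty_subset _⟩
  refine ⟨hstar ▸ hU, StarGraph.isGroupGeneratedBy_freeGroup,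
    ⟨_, _, isEmptyElim, heigen, isEmptyElim⟩, ?_⟩
  rintro lam φ φ' - - v ⟨-, a, ha, hPD⟩ v' hv t
  rw [hstar, StarGraph.projC_eq_one hno_eigen, Finset.univ_eq_empty, Finset.sum_empty, add_zero]
  exact StarGraph.isDeriv_reflectedGroup hv ha ((C.reflection_mulVec_eq_iff hR a).2 hPD) t
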